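/- Let $d\ge 2$, $\mathbf n=\mathbf e_1+\dots+\mathbf e_{d+1}$, and let $X^d=\mathbb Z^{d+1}/\mathbb Z\mathbf n$, made into a graph by joining $[\mathbf x]$ to $[\mathbf x\pm\mathbf e_i]$, $1\le i\le d+1$. Identify $[\mathbf x]\in X^d$ with the orthogonal projection of $\mathbf x$ to the hyperplane $H=\mathbf n^\perp\subset\mathbb R^{d+1}$, and let $\mathbf g_i\in H$ be the projection of $\mathbf e_i$. Let $\mathcal S=\{s\in H^*: s(\mathbf g_i)\le 1\text{ for all }i\}$, and for $n\ge1$ let $\mathcal S_n=\{s\in\mathcal S: s(\mathbf g_i)\in\frac1n\mathbb Z\text{ for all }i\}$ and $L_n=n(d+1)X^d$. Let $\Omega$ be the set of height functions, that is, of functions $f:X^d\to\mathbb Z$ with $f(\mathbf 0)\in(d+1)\mathbb Z$ and $f(\mathbf x+\mathbf g_i)-f(\mathbf x)\in\{-d,1\}$ for all $\mathbf x\in X^d$ and all $i$. Let $\mathcal F^\nabla$ be the $\sigma$-algebra on $\Omega$ generated by the maps $f\mapsto f(\mathbf x)-f(\mathbf y)$, and for $R\subset X^d$ let $\mathcal F_R$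 be the $\sigma$-algebra generated by the maps $f\mapsto f(\mathbf x)$, $\mathbf x\in R$. Let $\mu$ be a probability measure on $(\Omega,\mathcal F^\nabla)$. - $\mu$ is *shift-invariant* if $\mu(\tilde\theta_{\mathbf v}A)=\mu(A)$ for all $\mathbf v\in X^d$ and $A\in\mathcal F^\nabla$, where $\tilde\theta_{\mathbf v}f=f(\cdot+\mathbf v)-f(\mathbf v)+f(\mathbf 0)$. - A shift-invariant $\mu$ has *slope* $s\in H^*$ if $\mathbb E_\mu[f(\mathbf x)-f(\mathbf 0)]=s(\mathbf x)$ for all $\mathbf x\in X^d$. - $\mu$ is a *gradient Gibbs measure* if for every finite $R\subset X^d$ and $A\in\mathcal F^\nabla$ we have $\mu(A)=\int\gamma_R(A,f)\,d\mu(f)$, where $\gamma_R(\cdot,f)$ is the uniform probability measure on the finite set of height functions that agree with $f$ outside $R$. Theorem. For every $s\in\mathcal S$ there is a shift-invariant gradient Gibbs measure $\mu$ on $(\Omega,\mathcal F^\nabla)$ of slope $s$ such that, for all $\mathbf x,\mathbf y\in X^d$ with graph distance $n$, 1. $\operatorname{Var}_\mu(f(\mathbf y)-f(\mathbf x))\le(d+1)^2n$;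 2. $\mu\big(f(\mathbf y)-f(\mathbf x)-s(\mathbf y-\mathbf x)\ge(d+1)a\big)\le\exp\big(-\frac{a^2}{2n}\big)$ for all real $a\ge0$, whenever $n>0$; 3. $\mu\big(f(\mathbf y)-f(\mathbf x)-s(\mathbf y-\mathbf x)\le(d+1)a\big)\le\exp\big(-\frac{a^2}{2n}\big)$ for all real $a\le0$, whenever $n>0$. Moreover, $\mu$ can be chosen to be a local limit of uniform measures on periodic height functions: there are slopes $s_n\in\mathcal S_n$ ($n\ge1$) with $s_n\to s$ and positive integers $k_1<k_2<\cdots$ such that, with $\mu_n$ the uniform probability measure on the finite set of height functions $f$ that satisfy $f(\mathbf 0)=0$ and $f(\mathbf x+\mathbf y)=f(\mathbf x)+s_n(\mathbf y)$ for all $\mathbf x\in X^d$, $\mathbf y\in L_n$, we have $\mu_{k_j}(A)\to\mu(A)$ as $j\to\infty$ for every finite $R\subset X^d$ and every $A\in\mathcal F^\nabla\cap\mathcal F_R$. -/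

import Mathlib

open MeasureTheory Filter Topology
open scoped ENNReal

noncomputable section

namespace SimplicialLattice

/-- The vertex set `X^d = ℤ^{d+1} / ℤ n` of the simplicial lattice, where `n = (1, …, 1)`. -/
abbrev X (d : ℕ) : Type :=
  (Fin (d + 1) → ℤ) ⧸ AddSubgroup.zmultiples (fun _ : Fin (d + 1) => (1 : ℤ))

/-- The class `[e_i]` of the `i`-th unit vector. -/
def g {d : ℕ} (i : Fin (d + 1)) : X d :=
  QuotientAddGroup.mk (Pi.single i (1 : ℤ))

/-- The graph `(X^d, E^d)`: the neighbours of `x` are the vertices `x ± [e_i]`. -/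
def graph (d : ℕ) : SimpleGraph (X d) :=
  SimpleGraph.fromRel (fun x y => ∃ i, y = x + g i)

/-- The hyperplane `H ⊆ ℝ^{d+1}` orthogonal to `n`. -/
def H (d : ℕ) : Submodule ℝ (Fin (d + 1) → ℝ) where
  carrier := {v | ∑ i, v i = 0}
  zero_mem' := by simp
  add_mem' := by
    intro a b ha hb
    simp only [Set.mem_ofPred_eq] at ha hb ⊢
    simp [Finset.sum_add_distrib, ha, hb]
  smul_mem' := by
    intro c a ha
    simp only [Set.mem_ofPred_eq] at ha ⊢
    simp [← Finset.mul_sum, ha]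

/-- The orthogonal projection `x ↦ x - ((x, n) / (d + 1)) n` of an integer vector to `H`. -/
def projInt (d : ℕ) : (Fin (d + 1) → ℤ) →+ H d where
  toFun x := ⟨fun i => (x i : ℝ) - (∑ j, (x j : ℝ)) / (d + 1), by
    have h : ((d : ℝ) + 1) ≠ 0 := by positivity
    change ∑ i, ((x i : ℝ) - (∑ j, (x j : ℝ)) / (d + 1)) = 0
    rw [Finset.sum_sub_distrib]
    simp
    field_simp
    ring⟩
  map_zero' := by ext i; simp
  map_add' x y := by
    ext i
    simp [Finset.sum_add_distrib]
    ring

/-- The embedding `X^d → H`, `[x] ↦ P x`, identifying `X^d` with a lattice in `H`. -/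
def embed (d : ℕ) : X d →+ H d :=
  QuotientAddGroup.lift _ (projInt d) (by
    intro x hx
    obtain ⟨k, rfl⟩ := AddSubgroup.mem_zmultiples_iff.mp hx
    have h : ((d : ℝ) + 1) ≠ 0 := by positivity
    ext i
    simp [projInt]
    field_simp
    ring)

/-- The set `𝒮` of Lipschitz slopes. -/
def slopes (d : ℕ) : Set (Module.Dual ℝ (H d)) :=
  {s | ∀ i, s (embed d (g i)) ≤ 1}

/-- The set `𝒮_n` of Lipschitz slopes with `s(g_i) ∈ ℤ / n` for all `i`; used for `n ≥ 1`. -/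
def slopesN (d n : ℕ) : Set (Module.Dual ℝ (H d)) :=
  {s | s ∈ slopes d ∧ ∀ i, ∃ k : ℤ, s (embed d (g i)) = (k : ℝ) / n}

/-- Height functions: the elements of the sample space `Ω`. -/
structure HeightFunction (d : ℕ) where
  toFun : X d → ℤ
  zero_dvd : ((d : ℤ) + 1) ∣ toFun 0
  grad_mem : ∀ x i, toFun (x + g i) - toFun x = -(d : ℤ) ∨ toFun (x + g i) - toFun x = 1

instance (d : ℕ) : CoeFun (HeightFunction d) (fun _ => X d → ℤ) :=
  ⟨HeightFunction.toFun⟩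

/-- The gradient σ-algebra `ℱ^∇`, generated by all `f ↦ f(x) - f(y)`. It is the σ-algebra that
`Ω` carries by default, so that `Measure (HeightFunction d)` is the type of measures on
`(Ω, ℱ^∇)`. -/
instance gradientField (d : ℕ) : MeasurableSpace (HeightFunction d) :=
  ⨆ (x : X d) (y : X d), MeasurableSpace.comap (fun f : HeightFunction d => f x - f y) ⊤

/-- The σ-algebra `ℱ_R` generated by the values `f(x)`, `x ∈ R`. -/
@[reducible] def fieldOn {d : ℕ} (R : Set (X d)) : MeasurableSpace (HeightFunction d) :=
  ⨆ x ∈ R, MeasurableSpace.comap (fun f : HeightFunction d => f x) ⊤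

/-- The shift `θ̃_v f = f(· + v) - f(v) + f(0)`. -/
def shift {d : ℕ} (v : X d) (f : HeightFunction d) : HeightFunction d where
  toFun x := f (x + v) - f v + f 0
  zero_dvd := by simpa using f.zero_dvd
  grad_mem x i := by
    have h := f.grad_mem (x + v) i
    rw [add_right_comm x (g i) v]
    rcases h with h | h
    · left; linarith
    · right; linarith

/-- Shift-invariance: `μ(θ̃ A) = μ(A)` for all shifts and all `A ∈ ℱ^∇`. -/
def IsShiftInvariant {d : ℕ} (μ : Measure (HeightFunction d)) : Prop :=
  ∀ (v : X d) (A : Set (HeightFunction d)), MeasurableSet A → μ (shift v '' A) = μ A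

/-- `μ` has slope `s`: `s(x) = 𝔼_μ[f(x) - f(0)]` for all `x`. -/
def HasSlope {d : ℕ} (μ : Measure (HeightFunction d)) (s : Module.Dual ℝ (H d)) : Prop :=
  ∀ x : X d, ∫ f, ((f x : ℝ) - (f 0 : ℝ)) ∂μ = s (embed d x)

/-- The uniform probability measure on a finite non-empty set `S` of height functions,
as a measure on `(Ω, ℱ^∇)`. -/
def uniformMeasure {d : ℕ} (S : Set (HeightFunction d)) : Measure (HeightFunction d) :=
  (S.encard : ℝ≥0∞)⁻¹ • Measure.sum (fun h : S => Measure.dirac (h : HeightFunction d))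

/-- Fixed boundary conditions: `Ω(R, f)` is the set of height functions equal to `f` off `R`. -/
def fixedBC {d : ℕ} (R : Set (X d)) (f : HeightFunction d) : Set (HeightFunction d) :=
  {h | ∀ x, x ∉ R → h x = f x}

/-- Gradient Gibbs measures: the DLR equation `μ = μ γ_R^∇` holds on `ℱ^∇` for all finite `R`,
where `γ_R^∇(·, f)` is the uniform distribution on `Ω(R, f)`. -/
def IsGradientGibbs {d : ℕ} (μ : Measure (HeightFunction d)) : Prop :=
  ∀ R : Set (X d), R.Finite → ∀ A : Set (HeightFunction d), MeasurableSet A →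
    μ A = ∫⁻ f, uniformMeasure (fixedBC R f) A ∂μ

/-- Periodic boundary conditions: `Ω(L, s)` is the set of height functions `f` with `f(0) = 0`
and `f(x + y) = f(x) + s(y)` for `x ∈ X^d`, `y ∈ L`. -/
def periodicBC {d : ℕ} (L : AddSubgroup (X d)) (s : Module.Dual ℝ (H d)) :
    Set (HeightFunction d) :=
  {f | f 0 = 0 ∧ ∀ x, ∀ y ∈ L, (f (x + y) : ℝ) = f x + s (embed d y)}

/-- The lattice `L_n = n (d + 1) X^d`. -/
def latticeN (d n : ℕ) : AddSubgroup (X d) :=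
  (nsmulAddMonoidHom (α := X d) (n * (d + 1))).range

/-- Convergence of gradient measures in the topology of local convergence: convergence of the
probability of every event in `ℱ^∇ ∩ ℱ_R`, for every finite `R`. -/
def LocallyConverges {d : ℕ} (ν : ℕ → Measure (HeightFunction d))
    (μ : Measure (HeightFunction d)) : Prop :=
  ∀ R : Set (X d), R.Finite → ∀ A : Set (HeightFunction d),
    MeasurableSet A → MeasurableSet[fieldOn R] A →
      Tendsto (fun k => ν k A) atTop (𝓝 (μ A))

end SimplicialLattice

end

open SimplicialLattice

/-! Uniform measures on pinned periodic height functions satisfy the required bounds with constants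
that do not depend on the period, and pinned height functions form a compact space. A local limit
therefore exists and inherits the bounds.

Concentration. Put D = d + 1. All gradients are congruent to 1 modulo D, so two height functions
differ by a multiple of D at every vertex once they do so at the origin. Hence minima and maxima of
height functions are height functions (`IsHeight.inf`, `IsHeight.sup`), and the increment along an
edge takes one of two values at distance D. By the four functions theorem, raising the value at one
vertex by D changes the conditional mean at any other vertex by an amount between 0 and D
(`IsTranslationLattice.abs_coordAvg_sub_le`). Revealing the heights along a geodesic of length n
thus gives a martingale with n steps bounded by D, and Hoeffding's inequality yields the exponential
moment bound exp(l²D²n/2) (`IsTranslationLattice.sum_exp_le`). The mean is exactly the slope: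
shift-invariance makes it additive, and periodicity fixes it on the period lattice
(`sum_periodicBC`).

Gibbs property. When the period is large compared with R, resampling a periodic function on R
amounts to resampling it on all translates of R at once. Given the gradient off these translates,
the periodic measure hence has the conditional law prescribed by the kernel of R, on local events
(`integral_uniformMeasure_fixedBC_periodicBC`).

Limit. Any slope is approximated by rational ones, for which rounding a linear function down gives a
periodic height function. Compactness yields a convergent subsequence (`exists_local_limit`).
Shift-invariance, slope, the DLR equation and exponential moments are all tested on functions of
finitely many height differences, so they pass to the limit (`limit_properties`); local events form
a generating π-system. Variance and tail bounds follow from the exponential moments alone. -/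

noncomputable section

namespace SimplicialLattice

/-! ### Correlation inequalities and concentration on lattices of integer functions. -/

section Concentration

open scoped FinsetFamily

variable {α : Type*}

/-- Monotonicity of uniform averages: if `U ⊓ V ⊆ U` and `U ⊔ V ⊆ V`, then the average of every
coordinate over `U` is at most the one over `V`. -/
theorem sum_mul_card_le_card_mul_sum (U V : Finset (α → ℤ))
    (h : ∀ u ∈ U, ∀ v ∈ V, u ⊓ v ∈ U ∧ u ⊔ v ∈ V) (x : α) :
    (∑ u ∈ U, (u x : ℝ)) * V.card ≤ U.card * ∑ v ∈ V, (v x : ℝ) := by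
  classical
  -- The four functions theorem needs nonnegative functions. Adding C makes the coordinate
  -- nonnegative on `U ∪ V`, the truncation in `F` does the rest, and C cancels in the final
  -- inequality.
  set C : ℝ := ∑ u ∈ U ∪ V, |(u x : ℝ)| with hC
  have hpos : ∀ u ∈ U ∪ V, 0 ≤ (u x : ℝ) + C := by
    intro u hu
    have h1 : |(u x : ℝ)| ≤ C :=
      Finset.single_le_sum (f := fun u : α → ℤ => |(u x : ℝ)|) (fun _ _ => abs_nonneg _) hu
    have h2 := neg_abs_le (u x : ℝ)
    linarith
  set F : (α → ℤ) → ℝ := fun a => max ((a x : ℝ) + C) 0 with hF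
  have hF0 : ∀ a, 0 ≤ F a := fun a => le_max_right _ _
  have hFm : ∀ a b, F a ≤ F (a ⊔ b) := by
    intro a b
    apply max_le_max _ le_rfl
    have : a x ≤ (a ⊔ b) x := le_sup_left (a := a) (b := b) x
    have : (a x : ℝ) ≤ ((a ⊔ b) x : ℤ) := by exact_mod_cast this
    linarith
  have key := four_functions_theorem (fun a => if a ∈ U then F a else 0)
    (fun a => if a ∈ V then (1 : ℝ) else 0) (fun a => if a ∈ U then (1 : ℝ) else 0)
    (fun a => if a ∈ V then F a else 0)
    (fun a => by dsimp; split_ifs <;> simp [hF0])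
    (fun a => by dsimp; split_ifs <;> simp)
    (fun a => by dsimp; split_ifs <;> simp)
    (fun a => by dsimp; split_ifs <;> simp [hF0])
    (fun a b => by
      by_cases ha : a ∈ U
      · by_cases hb : b ∈ V
        · simp [ha, hb, h a ha b hb, hFm]
        · simp only [hb, if_false, mul_zero]
          exact mul_nonneg (by split_ifs <;> simp) (by split_ifs <;> simp [hF0])
      · simp only [ha, if_false, zero_mul]
        exact mul_nonneg (by split_ifs <;> simp) (by split_ifs <;> simp [hF0])) U V
  have e1 : ∑ a ∈ U, (if a ∈ U then F a else 0) = ∑ a ∈ U, (a x : ℝ) + U.card * C := by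
    rw [Finset.sum_congr rfl (g := fun a : α → ℤ => (a x : ℝ) + C)]
    · simp [Finset.sum_add_distrib]
    · intro a ha
      simp [ha, hF, hpos a (Finset.mem_union_left _ ha)]
  have e2 : ∑ a ∈ V, (if a ∈ V then (1 : ℝ) else 0) = V.card := by simp
  have e3 : ∑ a ∈ U ⊼ V, (if a ∈ U then (1 : ℝ) else 0) ≤ U.card := by
    rw [← Finset.sum_filter]
    simp only [Finset.sum_const, nsmul_eq_mul, mul_one]
    exact_mod_cast Finset.card_le_card (fun a ha => (Finset.mem_filter.mp ha).2)
  have e4 : ∑ a ∈ U ⊻ V, (if a ∈ V then F a else 0) ≤ ∑ a ∈ V, (a x : ℝ) + V.card * C := by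
    rw [← Finset.sum_filter]
    calc _ ≤ ∑ a ∈ V, F a := Finset.sum_le_sum_of_subset_of_nonneg
            (fun a ha => (Finset.mem_filter.mp ha).2) (fun a _ _ => hF0 a)
      _ = ∑ a ∈ V, ((a x : ℝ) + C) := Finset.sum_congr rfl fun a ha => by
            simp [hF, hpos a (Finset.mem_union_right _ ha)]
      _ = _ := by simp [Finset.sum_add_distrib]
  rw [e1, e2] at key
  have h0 : 0 ≤ ∑ a ∈ U ⊻ V, (if a ∈ V then F a else 0) :=
    Finset.sum_nonneg fun a _ => by split_ifs <;> simp [hF0]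
  have := key.trans (mul_le_mul e3 e4 h0 (Nat.cast_nonneg _))
  nlinarith

theorem exp_mul_le_cosh_add_sinh {D u l : ℝ} (hD : 0 < D) (hu : |u| ≤ D) :
    Real.exp (l * u) ≤ Real.cosh (l * D) + u / D * Real.sinh (l * D) := by
  have h := Real.exp_mul_le_cosh_add_mul_sinh (t := u / D)
    (by rwa [abs_div, abs_of_pos hD, div_le_one hD]) (l * D)
  rwa [show u / D * (l * D) = l * u by field_simp] at h

/-- Hoeffding's inequality for a two-point distribution with weights `a`, `b`. -/
theorem two_point_exp_le {a b x y D l : ℝ} (ha : 0 ≤ a) (hb : 0 ≤ b) (hx : |x| ≤ D) (hy : |y| ≤ D)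
    (h : a * x + b * y = 0) :
    a * Real.exp (l * x) + b * Real.exp (l * y) ≤ (a + b) * Real.exp (l ^ 2 * D ^ 2 / 2) := by
  rcases ((abs_nonneg x).trans hx).eq_or_lt with hD | hD
  · subst hD
    have hx0 : x = 0 := by simpa using hx
    have hy0 : y = 0 := by simpa using hy
    simp [hx0, hy0]
  · have h1 := mul_le_mul_of_nonneg_left (exp_mul_le_cosh_add_sinh (l := l) hD hx) ha
    have h2 := mul_le_mul_of_nonneg_left (exp_mul_le_cosh_add_sinh (l := l) hD hy) hb
    have h3 : Real.cosh (l * D) ≤ Real.exp (l ^ 2 * D ^ 2 / 2) := by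
      have := Real.cosh_le_exp_half_sq (l * D)
      rwa [mul_pow] at this
    have h4 := mul_le_mul_of_nonneg_left h3 (add_nonneg ha hb)
    refine (add_le_add h1 h2).trans (le_trans (le_of_eq ?_) h4)
    have : a * (x / D * Real.sinh (l * D)) + b * (y / D * Real.sinh (l * D)) =
        (a * x + b * y) * (Real.sinh (l * D) / D) := by ring
    rw [h] at this
    linarith

/-- A weighted mean lies between its two values, so neither is further from it than they are from
each other. -/
theorem abs_sub_weighted_mean_le {a b x y m D : ℝ} (ha : 0 < a) (hb : 0 < b)
    (hm : m * (a + b) = x * a + y * b) (hD : |y - x| ≤ D) : |x - m| ≤ D ∧ |y - m| ≤ D := by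
  have h1 : x - m = -(b / (a + b)) * (y - x) := by field_simp; linarith
  have h2 : y - m = (a / (a + b)) * (y - x) := by field_simp; linarith
  have h3 : a / (a + b) ≤ 1 := by rw [div_le_one (by positivity)]; linarith
  have h4 : b / (a + b) ≤ 1 := by rw [div_le_one (by positivity)]; linarith
  rw [h1, h2, abs_mul, abs_mul, abs_neg, abs_of_pos (a := a / (a + b)) (by positivity),
    abs_of_pos (a := b / (a + b)) (by positivity)]
  constructor <;> nlinarith [abs_nonneg (y - x)]

/-- The average of the `w`-th coordinate over a finite family of functions. -/
def coordAvg (W : Finset (α → ℤ)) (w : α) : ℝ := (∑ f ∈ W, (f w : ℝ)) / W.card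

theorem coordAvg_mul_card {W : Finset (α → ℤ)} (hW : W.Nonempty) (w : α) :
    coordAvg W w * W.card = ∑ f ∈ W, (f w : ℝ) := by
  have : (W.card : ℝ) ≠ 0 := by exact_mod_cast hW.card_pos.ne'
  rw [coordAvg]; field_simp

theorem coordAvg_le_coordAvg {U V : Finset (α → ℤ)} (hU : U.Nonempty) (hV : V.Nonempty)
    (h : ∀ u ∈ U, ∀ v ∈ V, u ⊓ v ∈ U ∧ u ⊔ v ∈ V) (x : α) : coordAvg U x ≤ coordAvg V x := by
  have := sum_mul_card_le_card_mul_sum U V h x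
  have hu : (0 : ℝ) < U.card := by exact_mod_cast hU.card_pos
  have hv : (0 : ℝ) < V.card := by exact_mod_cast hV.card_pos
  rw [coordAvg, coordAvg, div_le_div_iff₀ hu hv]
  linarith

/-- `W` is a lattice, and `W` lies below its translate by the constant `D` in the sense of
`W ⊓ (W + D) ⊆ W` and `W ⊔ (W + D) ⊆ W + D`. -/
def IsTranslationLattice (D : ℤ) (W : Set (α → ℤ)) : Prop :=
  ∀ f ∈ W, ∀ h ∈ W, f ⊓ h ∈ W ∧ f ⊔ h ∈ W ∧ (f ⊓ fun x => h x + D) ∈ W ∧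
    ((fun x => f x - D) ⊔ h) ∈ W

/-- This allows conditioning on one value after another along a walk. Since D ≥ 0, min(b, b + D) = b
and max(b - D, b) = b, so all four operations preserve the value b at `v`. -/
theorem IsTranslationLattice.filter {D : ℤ} (hD : 0 ≤ D) {W : Finset (α → ℤ)}
    (hW : IsTranslationLattice D (W : Set (α → ℤ))) (v : α) (b : ℤ) :
    IsTranslationLattice D ((W.filter fun f => f v = b : Finset (α → ℤ)) : Set (α → ℤ)) := by
  intro f hf h hh
  simp only [Finset.coe_filter, Set.mem_ofPred_eq] at hf hh ⊢
  obtain ⟨h1, h2, h3, h4⟩ := hW f hf.1 h hh.1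
  refine ⟨⟨h1, ?_⟩, ⟨h2, ?_⟩, ⟨h3, ?_⟩, ⟨h4, ?_⟩⟩
  · simp [hf.2, hh.2]
  · simp [hf.2, hh.2]
  · simp [hf.2, hh.2, hD]
  · simp [hf.2, hh.2, hD]

/-- Two monotonicity comparisons: the functions with value b lie below those with value b + D, and
the latter lie below the former raised by D. So the difference of averages is in [0, D]. -/
theorem IsTranslationLattice.abs_coordAvg_sub_le {D : ℤ} (hD : 0 ≤ D) {W : Finset (α → ℤ)}
    (hW : IsTranslationLattice D (W : Set (α → ℤ))) {v : α} {b : ℤ}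
    (h0 : (W.filter fun f => f v = b).Nonempty) (h1 : (W.filter fun f => f v = b + D).Nonempty)
    (w : α) :
    |coordAvg (W.filter fun f => f v = b + D) w - coordAvg (W.filter fun f => f v = b) w| ≤ D := by
  classical
  have low := coordAvg_le_coordAvg h0 h1 (by
    intro f hf h hh
    simp only [Finset.mem_filter] at hf hh ⊢
    obtain ⟨g1, g2, -, -⟩ := hW f hf.1 h hh.1
    exact ⟨⟨g1, by simp [hf.2, hh.2, hD]⟩, ⟨g2, by simp [hf.2, hh.2, hD]⟩⟩) w
  obtain ⟨e, he⟩ : ∃ e : (α → ℤ) ↪ (α → ℤ), ∀ h, e h = fun x => h x + D :=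
    ⟨(Equiv.addRight fun _ : α => D).toEmbedding, fun _ => rfl⟩
  have high := coordAvg_le_coordAvg h1 (h0.map (f := e)) (by
    intro f hf h hh
    simp only [Finset.mem_filter, Finset.mem_map] at hf hh ⊢
    obtain ⟨h, hh, rfl⟩ := hh
    obtain ⟨-, -, g3, g4⟩ := hW f hf.1 h hh.1
    rw [he]
    refine ⟨⟨g3, by simp [hf.2, hh.2]⟩, ⟨_, ⟨g4, by simp [hf.2, hh.2]⟩, ?_⟩⟩
    funext x
    simp only [he, Pi.sup_apply]
    rw [← max_add_add_right]; simp) w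
  have e2 : coordAvg ((W.filter fun f => f v = b).map e) w =
      coordAvg (W.filter fun f => f v = b) w + D := by
    have : ((W.filter fun f => f v = b).card : ℝ) ≠ 0 := by exact_mod_cast h0.card_pos.ne'
    simp only [coordAvg, Finset.sum_map, Finset.card_map, he, Int.cast_add,
      Finset.sum_add_distrib, Finset.sum_const, nsmul_eq_mul]
    field_simp
  rw [e2] at high
  rw [abs_le]
  have hD' : (0 : ℝ) ≤ D := by exact_mod_cast hD
  constructor <;> linarith

/-- Exponential moments of the uniform measure on a translation lattice whose coordinates change
by one of two values at distance `D` along each edge of a walk. -/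
theorem IsTranslationLattice.sum_exp_le {D : ℤ} (hD : 0 ≤ D) (l : ℝ) {G : SimpleGraph α} {u w : α}
    (p : G.Walk u w) : ∀ {W : Finset (α → ℤ)}, IsTranslationLattice D (W : Set (α → ℤ)) →
    (∀ a b, G.Adj a b → ∃ c, ∀ f ∈ W, f b - f a = c ∨ f b - f a = c + D) →
    (∃ c, ∀ f ∈ W, f u = c) →
    ∑ f ∈ W, Real.exp (l * (f w - coordAvg W w)) ≤
      W.card * Real.exp (l ^ 2 * D ^ 2 / 2 * p.length) := by
  classical
  induction p with
  | @nil u =>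
    rintro W - - ⟨c, hc⟩
    rcases W.eq_empty_or_nonempty with rfl | hne
    · simp
    have : (W.card : ℝ) ≠ 0 := by exact_mod_cast hne.card_pos.ne'
    have e : coordAvg W u = c := by
      rw [coordAvg, Finset.sum_congr rfl (fun f hf => by rw [hc f hf])]
      simp; field_simp
    rw [Finset.sum_congr rfl (fun f hf => by rw [e, hc f hf])]
    simp
  | @cons u v w hadj p ih =>
    rintro W hW hstep ⟨c, hc⟩
    obtain ⟨b', hb'⟩ := hstep u v hadj
    set b := b' + c with hb
    have hv : ∀ f ∈ W, f v = b ∨ f v = b + D := by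
      intro f hf
      have := hb' f hf
      rw [hc f hf] at this
      rcases this with h | h
      · left; linarith
      · right; linarith
    have hexp : Real.exp (l ^ 2 * D ^ 2 / 2 * ((SimpleGraph.Walk.cons hadj p).length : ℝ)) =
        Real.exp (l ^ 2 * D ^ 2 / 2) * Real.exp (l ^ 2 * D ^ 2 / 2 * p.length) := by
      rw [← Real.exp_add]; congr 1; simp [SimpleGraph.Walk.length_cons]; ring
    have hone : (1 : ℝ) ≤ Real.exp (l ^ 2 * D ^ 2 / 2) := Real.one_le_exp (by positivity)
    -- If only one value occurs at `v`, the step reveals nothing; the induction hypothesis applies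
    -- to all of `W` and the extra factor is at least 1.
    have single : (∃ c, ∀ f ∈ W, f v = c) → ∑ f ∈ W, Real.exp (l * (f w - coordAvg W w)) ≤
        W.card * Real.exp (l ^ 2 * D ^ 2 / 2 * (SimpleGraph.Walk.cons hadj p).length) := by
      intro hcv
      refine (ih hW hstep hcv).trans ?_
      rw [hexp]
      have := (Real.exp_pos (l ^ 2 * D ^ 2 / 2 * p.length)).le
      gcongr
      nlinarith
    set W0 := W.filter fun f => f v = b with hW0
    set W1 := W.filter fun f => f v = b + D with hW1
    rcases hD.eq_or_lt with hD0 | hDpos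
    · exact single ⟨b, fun f hf => by have := hv f hf; rw [← hD0] at this; simpa using this⟩
    rcases W0.eq_empty_or_nonempty with h0 | h0
    · exact single ⟨b + D, fun f hf => (hv f hf).resolve_left fun h => by
        have : f ∈ W0 := Finset.mem_filter.mpr ⟨hf, h⟩
        simp [h0] at this⟩
    rcases W1.eq_empty_or_nonempty with h1 | h1
    · exact single ⟨b, fun f hf => (hv f hf).resolve_right fun h => by
        have : f ∈ W1 := Finset.mem_filter.mpr ⟨hf, h⟩
        simp [h1] at this⟩
    have hdisj : Disjoint W0 W1 := by
      rw [Finset.disjoint_left]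
      intro f hf hf'
      have a1 := (Finset.mem_filter.mp hf).2
      have a2 := (Finset.mem_filter.mp hf').2
      omega
    have hun : W = W0 ∪ W1 := by
      ext f
      simp only [hW0, hW1, Finset.mem_union, Finset.mem_filter]
      constructor
      · intro hf
        rcases hv f hf with h | h
        · exact Or.inl ⟨hf, h⟩
        · exact Or.inr ⟨hf, h⟩
      · rintro (h | h) <;> exact h.1
    have hm := hW.abs_coordAvg_sub_le hD h0 h1 w
    have hne : W.Nonempty := by rw [hun]; exact h0.mono Finset.subset_union_left
    have hcard : (W.card : ℝ) = W0.card + W1.card := by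
      conv_lhs => rw [hun]
      rw [Finset.card_union_of_disjoint hdisj]; push_cast; ring
    have hsum : coordAvg W w * W.card = coordAvg W0 w * W0.card + coordAvg W1 w * W1.card := by
      rw [coordAvg_mul_card hne, coordAvg_mul_card h0, coordAvg_mul_card h1]
      conv_lhs => rw [hun]
      rw [Finset.sum_union hdisj]
    have ih0 := ih (hW.filter hD v b)
      (fun a b' h => (hstep a b' h).imp fun c hc f hf => hc f (Finset.mem_filter.mp hf).1)
      ⟨b, fun f hf => (Finset.mem_filter.mp hf).2⟩
    have ih1 := ih (hW.filter hD v (b + D))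
      (fun a b' h => (hstep a b' h).imp fun c hc f hf => hc f (Finset.mem_filter.mp hf).1)
      ⟨b + D, fun f hf => (Finset.mem_filter.mp hf).2⟩
    rw [← hW0] at ih0 hm
    rw [← hW1] at ih1 hm
    set n0 : ℝ := (W0.card : ℝ)
    set n1 : ℝ := (W1.card : ℝ)
    have hn0 : 0 < n0 := Nat.cast_pos.mpr h0.card_pos
    have hn1 : 0 < n1 := Nat.cast_pos.mpr h1.card_pos
    set m := coordAvg W w
    set m0 := coordAvg W0 w
    set m1 := coordAvg W1 w
    have hmm : m * (n0 + n1) = m0 * n0 + m1 * n1 := by rw [← hcard]; exact hsum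
    -- One martingale step: the conditional means `m0`, `m1` given the value at `v` deviate from the
    -- overall mean by at most D, and their weighted deviations cancel.
    obtain ⟨b0, b1⟩ := abs_sub_weighted_mean_le hn0 hn1 hmm hm
    have two := two_point_exp_le (l := l) hn0.le hn1.le b0 b1 (by linarith)
    have split : ∀ (V : Finset (α → ℤ)) (q : ℝ),
        ∑ f ∈ V, Real.exp (l * (f w - m)) =
          Real.exp (l * (q - m)) * ∑ f ∈ V, Real.exp (l * (f w - q)) := by
      intro V q
      rw [Finset.mul_sum]
      refine Finset.sum_congr rfl fun f _ => ?_
      rw [← Real.exp_add]; congr 1; ring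
    have hEq : ∑ f ∈ W, Real.exp (l * (f w - m)) =
        Real.exp (l * (m0 - m)) * ∑ f ∈ W0, Real.exp (l * (f w - m0)) +
        Real.exp (l * (m1 - m)) * ∑ f ∈ W1, Real.exp (l * (f w - m1)) := by
      conv_lhs => rw [hun]
      rw [Finset.sum_union hdisj, split W0 m0, split W1 m1]
    rw [hEq, hexp, hcard]
    set E := Real.exp (l ^ 2 * D ^ 2 / 2 * p.length) with hE
    have hEpos : 0 ≤ E := (Real.exp_pos _).le
    calc _ ≤ Real.exp (l * (m0 - m)) * (n0 * E) + Real.exp (l * (m1 - m)) * (n1 * E) := by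
            gcongr
      _ = (n0 * Real.exp (l * (m0 - m)) + n1 * Real.exp (l * (m1 - m))) * E := by ring
      _ ≤ ((n0 + n1) * Real.exp (l ^ 2 * D ^ 2 / 2)) * E := by gcongr
      _ = _ := by ring

end Concentration

/-! ### Generators, connectedness and translations of the lattice. -/

section Lattice

variable {d : ℕ}

theorem mk_const (k : ℤ) : (QuotientAddGroup.mk (fun _ => k) : X d) = 0 := by
  rw [QuotientAddGroup.eq_zero_iff, AddSubgroup.mem_zmultiples_iff]
  exact ⟨k, by funext i; simp⟩

theorem mk_eq_sum (v : Fin (d + 1) → ℤ) : (QuotientAddGroup.mk v : X d) = ∑ i, v i • g i := by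
  have h : v = ∑ i, v i • Pi.single i (1 : ℤ) := by
    funext j; simp [Finset.sum_apply, Pi.single_apply]
  conv_lhs => rw [h]
  rw [← QuotientAddGroup.mk'_apply, map_sum]
  simp [g]

theorem sum_g : ∑ i, (g i : X d) = 0 := by
  have := mk_eq_sum (d := d) (fun _ => 1)
  rw [mk_const] at this
  simpa using this.symm

theorem closure_range_g : AddSubgroup.closure (Set.range (g : Fin (d + 1) → X d)) = ⊤ := by
  rw [eq_top_iff]
  rintro x -
  obtain ⟨v, rfl⟩ := QuotientAddGroup.mk_surjective x
  rw [mk_eq_sum]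
  exact AddSubgroup.sum_mem _ fun i _ =>
    AddSubgroup.zsmul_mem _ (AddSubgroup.subset_closure (Set.mem_range_self i)) _

theorem lattice_induction {P : X d → Prop} (h0 : P 0) (h : ∀ x i, P x ↔ P (x + g i)) (x : X d) :
    P x := by
  have hx : x ∈ AddSubgroup.closure (Set.range (g : Fin (d + 1) → X d)) := by
    rw [closure_range_g]; trivial
  induction hx using AddSubgroup.closure_induction_right with
  | zero => exact h0
  | add_right x hx y hy ih =>
    obtain ⟨i, rfl⟩ := hy
    exact (h x i).mp ih
  | add_neg_cancel x hx y hy ih =>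
    obtain ⟨i, rfl⟩ := hy
    rw [h _ i]
    simpa using ih

theorem graph_adj_iff {x y : X d} :
    (graph d).Adj x y ↔ x ≠ y ∧ ((∃ i, y = x + g i) ∨ ∃ i, x = y + g i) := by
  rw [graph, SimpleGraph.fromRel_adj]

theorem reachable_add_g (x : X d) (i : Fin (d + 1)) : (graph d).Reachable x (x + g i) := by
  by_cases h : x = x + g i
  · rw [← h]
  · exact SimpleGraph.Adj.reachable (graph_adj_iff.mpr ⟨h, Or.inl ⟨i, rfl⟩⟩)

theorem reachable (x y : X d) : (graph d).Reachable x y := by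
  have : ∀ x : X d, (graph d).Reachable 0 x :=
    lattice_induction (SimpleGraph.Reachable.refl _) fun x i =>
      ⟨fun h => h.trans (reachable_add_g x i), fun h => h.trans (reachable_add_g x i).symm⟩
  exact (this x).symm.trans (this y)

/-- Translations are automorphisms of the graph. -/
def translateHom (v : X d) : graph d →g graph d where
  toFun x := x + v
  map_rel' := by
    intro a b hab
    rw [graph_adj_iff] at hab ⊢
    obtain ⟨h1, h2⟩ := hab
    refine ⟨fun h => h1 (add_right_cancel h), ?_⟩
    rcases h2 with ⟨i, rfl⟩ | ⟨i, rfl⟩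
    · exact Or.inl ⟨i, by abel⟩
    · exact Or.inr ⟨i, by abel⟩

/-- Translate a geodesic by `-x`. The walk has to start at the origin because periodic height
functions are pinned there. -/
theorem exists_walk_zero_length_eq_dist (x y : X d) :
    ∃ p : (graph d).Walk 0 (y - x), p.length = (graph d).dist x y := by
  obtain ⟨p, hp⟩ := (reachable x y).exists_walk_length_eq_dist
  have e1 : translateHom (-x) x = 0 := by simp [translateHom]
  have e2 : translateHom (-x) y = y - x := by simp [translateHom, sub_eq_add_neg]
  refine ⟨(p.map (translateHom (-x))).copy e1 e2, ?_⟩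
  simp [hp]

end Lattice

/-! ### Height functions: congruence modulo d + 1, lattice operations, shifts. -/

section Height

variable {d : ℕ}

/-- The predicate on functions that defines height functions. -/
def IsHeight (u : X d → ℤ) : Prop :=
  ((d : ℤ) + 1) ∣ u 0 ∧ ∀ x i, u (x + g i) - u x = -(d : ℤ) ∨ u (x + g i) - u x = 1

theorem HeightFunction.isHeight (f : HeightFunction d) : IsHeight f.toFun :=
  ⟨f.zero_dvd, f.grad_mem⟩

theorem HeightFunction.toFun_injective :
    Function.Injective (HeightFunction.toFun : HeightFunction d → X d → ℤ) := by
  rintro ⟨a, _, _⟩ ⟨b, _, _⟩ h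
  cases h
  rfl

/-- Both admissible gradients are 1 modulo d + 1, so the residue of a difference of height functions
is the same at all vertices. -/
theorem IsHeight.dvd_sub {u v : X d → ℤ} (hu : IsHeight u) (hv : IsHeight v) (x : X d) :
    ((d : ℤ) + 1) ∣ u x - v x := by
  induction x using lattice_induction with
  | h0 => exact _root_.dvd_sub hu.1 hv.1
  | h x i =>
    rcases hu.2 x i with h1 | h1 <;> rcases hv.2 x i with h2 | h2
    · rw [show u (x + g i) - v (x + g i) = u x - v x by linarith]
    · rw [show u (x + g i) - v (x + g i) = u x - v x - ((d : ℤ) + 1) by linarith]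
      simp
    · rw [show u (x + g i) - v (x + g i) = u x - v x + ((d : ℤ) + 1) by linarith]
      simp
    · rw [show u (x + g i) - v (x + g i) = u x - v x by linarith]

theorem IsHeight.add_le_of_lt {u v : X d → ℤ} (hu : IsHeight u) (hv : IsHeight v) {x : X d}
    (h : u x < v x) : u x + (d + 1) ≤ v x := by
  have := Int.le_of_dvd (by linarith) (hv.dvd_sub hu x)
  linarith

/-- If the two functions differ at `x`, they do so by at least d + 1, and one step changes the
difference by at most d + 1. The order at `x` thus persists weakly at the neighbour, and the minimum
follows a single function along the edge. -/
theorem IsHeight.inf {u v : X d → ℤ} (hu : IsHeight u) (hv : IsHeight v) : IsHeight (u ⊓ v) := by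
  constructor
  · rcases le_total (u 0) (v 0) with h | h <;> simp [h, hu.1, hv.1]
  · intro x i
    have h1 := hu.2 x i
    have h2 := hv.2 x i
    simp only [Pi.inf_apply]
    rcases lt_trichotomy (u x) (v x) with h | h | h
    · have := hu.add_le_of_lt hv h
      omega
    · omega
    · have := hv.add_le_of_lt hu h
      omega

theorem IsHeight.sup {u v : X d → ℤ} (hu : IsHeight u) (hv : IsHeight v) : IsHeight (u ⊔ v) := by
  constructor
  · rcases le_total (u 0) (v 0) with h | h <;> simp [h, hu.1, hv.1]
  · intro x i
    have h1 := hu.2 x i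
    have h2 := hv.2 x i
    simp only [Pi.sup_apply]
    rcases lt_trichotomy (u x) (v x) with h | h | h
    · have := hu.add_le_of_lt hv h
      omega
    · omega
    · have := hv.add_le_of_lt hu h
      omega

theorem IsHeight.add_const {u : X d → ℤ} (hu : IsHeight u) {c : ℤ} (hc : ((d : ℤ) + 1) ∣ c) :
    IsHeight fun x => u x + c :=
  ⟨dvd_add hu.1 hc, fun x i => by simpa using hu.2 x i⟩

theorem exists_forall_abs_sub_le (x : X d) :
    ∃ B : ℤ, ∀ f : HeightFunction d, |f x - f 0| ≤ B := by
  induction x using lattice_induction with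
  | h0 => exact ⟨0, by simp⟩
  | h x i =>
    constructor
    · rintro ⟨B, hB⟩
      refine ⟨B + (d + 1), fun f => ?_⟩
      have h1 := abs_le.mp (hB f)
      have h2 := f.grad_mem x i
      rw [abs_le]
      omega
    · rintro ⟨B, hB⟩
      refine ⟨B + (d + 1), fun f => ?_⟩
      have h1 := abs_le.mp (hB f)
      have h2 := f.grad_mem x i
      rw [abs_le]
      omega

/-- Against the orientation of a generator the increments are -1 and d, hence the second constant.
-/
theorem HeightFunction.sub_eq_or_of_adj {a b : X d} (h : (graph d).Adj a b) :
    ∃ c : ℤ, ∀ f : HeightFunction d, f b - f a = c ∨ f b - f a = c + (d + 1) := by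
  rcases (graph_adj_iff.mp h).2 with ⟨i, rfl⟩ | ⟨i, rfl⟩
  · refine ⟨-d, fun f => ?_⟩
    have := f.grad_mem a i
    omega
  · refine ⟨-1, fun f => ?_⟩
    have := f.grad_mem b i
    omega

theorem shift_shift_neg (v : X d) (f : HeightFunction d) : shift v (shift (-v) f) = f := by
  apply HeightFunction.toFun_injective
  funext x
  simp [shift]

theorem shift_neg_shift (v : X d) (f : HeightFunction d) : shift (-v) (shift v f) = f := by
  simpa using shift_shift_neg (-v) f

theorem image_shift (v : X d) (A : Set (HeightFunction d)) : shift v '' A = shift (-v) ⁻¹' A :=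
  congrFun (Set.image_eq_preimage_of_inverse (shift_neg_shift v) (shift_shift_neg v)) A

theorem shift_injective (v : X d) : Function.Injective (shift v : HeightFunction d → _) :=
  Function.LeftInverse.injective (shift_neg_shift v)

end Height

/-! ### Periodic height functions: lattice structure, existence, mean and exponential moments. -/

section Periodic

variable {d : ℕ} {L : AddSubgroup (X d)} {s : Module.Dual ℝ (H d)}

theorem shift_mem_periodicBC {f : HeightFunction d} (hf : f ∈ periodicBC L s) (v : X d) :
    shift v f ∈ periodicBC L s := by
  refine ⟨by simp [shift, hf.1], fun x y hy => ?_⟩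
  have := hf.2 (x + v) y hy
  simp only [shift, Int.cast_add, Int.cast_sub]
  rw [add_right_comm, this]
  ring

theorem shift_preimage_periodicBC (v : X d) : shift v ⁻¹' periodicBC L s = periodicBC L s := by
  ext f
  refine ⟨fun h => ?_, fun h => shift_mem_periodicBC h v⟩
  rw [← shift_neg_shift v f]
  exact shift_mem_periodicBC h _

/-- Quasi-periodicity survives minima and maxima because both functions acquire the same increment.
The translate by d + 1 is a height function but is not pinned; the minimum with it, or the maximum
with the lowered function, is pinned again. -/
theorem isTranslationLattice_periodicBC :
    IsTranslationLattice ((d : ℤ) + 1) (HeightFunction.toFun '' periodicBC L s) := by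
  have hper : ∀ u v : X d → ℤ, (∀ x, ∀ y ∈ L, (u (x + y) : ℝ) = u x + s (embed d y)) →
      (∀ x, ∀ y ∈ L, (v (x + y) : ℝ) = v x + s (embed d y)) →
      (∀ x, ∀ y ∈ L, (((u ⊓ v) (x + y) : ℤ) : ℝ) = ((u ⊓ v) x : ℤ) + s (embed d y)) ∧
      (∀ x, ∀ y ∈ L, (((u ⊔ v) (x + y) : ℤ) : ℝ) = ((u ⊔ v) x : ℤ) + s (embed d y)) := by
    intro u v hu hv
    constructor <;> intro x y hy
    · simp only [Pi.inf_apply, Int.cast_min]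
      rw [hu x y hy, hv x y hy, min_add_add_right]
    · simp only [Pi.sup_apply, Int.cast_max]
      rw [hu x y hy, hv x y hy, max_add_add_right]
  have mem : ∀ u : X d → ℤ, IsHeight u → u 0 = 0 →
      (∀ x, ∀ y ∈ L, (u (x + y) : ℝ) = u x + s (embed d y)) →
      u ∈ HeightFunction.toFun '' periodicBC L s :=
    fun u h1 h2 h3 => ⟨⟨u, h1.1, h1.2⟩, ⟨h2, h3⟩, rfl⟩
  rintro _ ⟨f, hf, rfl⟩ _ ⟨h, hh, rfl⟩
  have hD : (0 : ℤ) ≤ (d : ℤ) + 1 := by positivity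
  have hf' : ∀ x, ∀ y ∈ L, (((fun x => f x - ((d : ℤ) + 1)) (x + y) : ℤ) : ℝ) =
      ((fun x => f x - ((d : ℤ) + 1)) x : ℤ) + s (embed d y) := by
    intro x y hy
    have := hf.2 x y hy
    push_cast
    linarith
  have hh' : ∀ x, ∀ y ∈ L, (((fun x => h x + ((d : ℤ) + 1)) (x + y) : ℤ) : ℝ) =
      ((fun x => h x + ((d : ℤ) + 1)) x : ℤ) + s (embed d y) := by
    intro x y hy
    have := hh.2 x y hy
    push_cast
    linarith
  refine ⟨mem _ (f.isHeight.inf h.isHeight) ?_ (hper _ _ hf.2 hh.2).1,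
    mem _ (f.isHeight.sup h.isHeight) ?_ (hper _ _ hf.2 hh.2).2,
    mem _ (f.isHeight.inf (h.isHeight.add_const dvd_rfl)) ?_ (hper _ _ hf.2 hh').1,
    mem _ ((f.isHeight.add_const (c := -((d : ℤ) + 1)) (dvd_neg.mpr dvd_rfl)).sup h.isHeight) ?_
      (hper _ _ hf' hh.2).2⟩
  · simp [hf.1, hh.1]
  · simp [hf.1, hh.1]
  · simp [hf.1, hh.1, hD]
  · simp only [Pi.sup_apply]
    rw [hf.1, hh.1]
    omega

/-- A periodic function is determined by its values at the finitely many representatives with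
coordinates in [0, N), and pinning bounds each of these values. -/
theorem finite_periodicBC {n : ℕ} (hn : 0 < n) (s : Module.Dual ℝ (H d)) :
    (periodicBC (latticeN d n) s).Finite := by
  set N := n * (d + 1) with hN
  have hNpos : 0 < N := by positivity
  choose B hB using exists_forall_abs_sub_le (d := d)
  let r : (Fin (d + 1) → Fin N) → X d := fun v => QuotientAddGroup.mk fun i => ((v i : ℕ) : ℤ)
  have hr : ∀ x : X d, ∃ v, ∃ y ∈ latticeN d n, x = r v + y := by
    intro x
    obtain ⟨v, rfl⟩ := QuotientAddGroup.mk_surjective x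
    refine ⟨fun i => ⟨(v i % N).toNat, ?_⟩, N • QuotientAddGroup.mk fun i => v i / N,
      ⟨_, rfl⟩, ?_⟩
    · have h1 := Int.emod_lt_of_pos (v i) (by exact_mod_cast hNpos : (0 : ℤ) < N)
      omega
    · rw [← QuotientAddGroup.mk_nsmul, ← QuotientAddGroup.mk_add]
      congr 1
      funext i
      have h1 := Int.emod_nonneg (v i) (by exact_mod_cast hNpos.ne' : (N : ℤ) ≠ 0)
      simp only [Pi.add_apply, nsmul_eq_mul, Int.toNat_of_nonneg h1]
      exact (Int.emod_add_mul_ediv (v i) N).symm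
  refine Set.Finite.of_finite_image
    (f := fun f : HeightFunction d => fun v => f (r v)) ?_ ?_
  · refine (Set.finite_Icc (fun v => -B (r v)) (fun v => B (r v))).subset ?_
    rintro _ ⟨f, hf, rfl⟩
    have h : ∀ v, -B (r v) ≤ f (r v) ∧ f (r v) ≤ B (r v) := by
      intro v
      have := hB (r v) f
      rwa [hf.1, sub_zero, abs_le] at this
    exact ⟨fun v => (h v).1, fun v => (h v).2⟩
  · intro f hf h hh hfh
    apply HeightFunction.toFun_injective
    funext x
    obtain ⟨v, y, hy, rfl⟩ := hr x
    have h1 := hf.2 (r v) y hy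
    have h2 := hh.2 (r v) y hy
    have h3 : f (r v) = h (r v) := congrFun hfh v
    rw [h3, ← h2] at h1
    exact_mod_cast h1

theorem sum_slope_eq_zero (s : Module.Dual ℝ (H d)) : ∑ i, s (embed d (g i)) = 0 := by
  rw [← map_sum, ← map_sum, sum_g, map_zero, map_zero]

theorem neg_le_slope {s : Module.Dual ℝ (H d)} (hs : s ∈ slopes d) (i : Fin (d + 1)) :
    -(d : ℝ) ≤ s (embed d (g i)) := by
  have h := sum_slope_eq_zero s
  rw [← Finset.add_sum_erase _ _ (Finset.mem_univ i)] at h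
  have h2 : ∑ j ∈ Finset.univ.erase i, s (embed d (g j)) ≤ ∑ j ∈ Finset.univ.erase i, (1 : ℝ) :=
    Finset.sum_le_sum fun j _ => hs j
  simp only [Finset.sum_const, Finset.card_erase_of_mem (Finset.mem_univ i), Finset.card_univ,
    Fintype.card_fin, add_tsub_cancel_right, nsmul_eq_mul, mul_one] at h2
  linarith

theorem slope_mk (s : Module.Dual ℝ (H d)) (v : Fin (d + 1) → ℤ) :
    s (embed d (QuotientAddGroup.mk v)) = ∑ i, (v i : ℝ) * s (embed d (g i)) := by
  rw [mk_eq_sum, map_sum, map_sum]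
  refine Finset.sum_congr rfl fun i _ => ?_
  rw [map_zsmul, map_zsmul, zsmul_eq_mul]

/-- The largest height function below the linear function `s`, as a function of representatives. -/
def floorHeight (s : Module.Dual ℝ (H d)) (v : Fin (d + 1) → ℤ) : ℤ :=
  ∑ i, v i + (d + 1) * ⌊(s (embed d (QuotientAddGroup.mk v)) - (∑ i, v i : ℤ)) / ((d : ℝ) + 1)⌋

theorem floorHeight_add_const (s : Module.Dual ℝ (H d)) (v : Fin (d + 1) → ℤ) (k : ℤ) :
    floorHeight s (v + fun _ => k) = floorHeight s v := by
  have hd : (d : ℝ) + 1 ≠ 0 := by positivity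
  have hsum : ∑ i, (v + fun _ => k : Fin (d + 1) → ℤ) i = ∑ i, v i + (d + 1) * k := by
    simp [Finset.sum_add_distrib]
  rw [floorHeight, floorHeight, QuotientAddGroup.mk_add, mk_const, add_zero, hsum]
  have : (s (embed d (QuotientAddGroup.mk v)) - (∑ i, v i + (d + 1) * k : ℤ)) / ((d : ℝ) + 1) =
      (s (embed d (QuotientAddGroup.mk v)) - (∑ i, v i : ℤ)) / ((d : ℝ) + 1) - (k : ℤ) := by
    push_cast; field_simp; ring
  rw [this, Int.floor_sub_intCast]
  ring

/-- The argument of the floor moves by (s(g_i) - 1)/(d + 1), which lies in [-1, 0] for a Lipschitz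
slope. The floor therefore drops by 0 or 1, and the height changes by 1 or by 1 - (d + 1). -/
theorem floorHeight_add_single {s : Module.Dual ℝ (H d)} (hs : s ∈ slopes d)
    (v : Fin (d + 1) → ℤ) (i : Fin (d + 1)) :
    floorHeight s (v + Pi.single i 1) - floorHeight s v = -(d : ℤ) ∨
      floorHeight s (v + Pi.single i 1) - floorHeight s v = 1 := by
  have hd : (0 : ℝ) < (d : ℝ) + 1 := by positivity
  set t : ℝ := (s (embed d (QuotientAddGroup.mk v)) - (∑ i, v i : ℤ)) / ((d : ℝ) + 1) with ht
  set δ : ℝ := (s (embed d (g i)) - 1) / ((d : ℝ) + 1) with hδ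
  have h1 : δ ≤ 0 := div_nonpos_of_nonpos_of_nonneg (by linarith [hs i]) hd.le
  have h2 : -1 ≤ δ := by rw [hδ, le_div_iff₀ hd]; linarith [neg_le_slope hs i]
  have hsum : ∑ j, (v + Pi.single i 1 : Fin (d + 1) → ℤ) j = ∑ j, v j + 1 := by
    simp [Finset.sum_add_distrib]
  have hmk : (QuotientAddGroup.mk (v + Pi.single i 1) : X d) = QuotientAddGroup.mk v + g i := by
    rw [QuotientAddGroup.mk_add, g]
  have e : (s (embed d (QuotientAddGroup.mk v + g i)) - (∑ j, v j + 1 : ℤ)) / ((d : ℝ) + 1) =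
      t + δ := by
    rw [map_add, map_add, ht, hδ]
    push_cast
    ring
  rw [floorHeight, floorHeight, hsum, hmk, e, ← ht]
  have f1 : ⌊t + δ⌋ ≤ ⌊t⌋ := Int.floor_le_floor (by linarith)
  have f2 : ⌊t⌋ - 1 ≤ ⌊t + δ⌋ := by
    rw [← Int.floor_sub_one]; exact Int.floor_le_floor (by linarith)
  obtain h | h : ⌊t + δ⌋ = ⌊t⌋ ∨ ⌊t + δ⌋ = ⌊t⌋ - 1 := by omega
  · right; rw [h]; ring
  · left; rw [h]; ring

/-- For a slope in (1/n)ℤ, both s and the coordinate sum change by a multiple of d + 1 along the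
period, so the argument of the floor changes by an integer. -/
theorem floorHeight_add_smul {s : Module.Dual ℝ (H d)} {n : ℕ} (hn : 0 < n) (hs : s ∈ slopesN d n)
    (v q : Fin (d + 1) → ℤ) :
    (floorHeight s (v + (n * (d + 1)) • q) : ℝ) = floorHeight s v +
      s (embed d ((n * (d + 1)) • (QuotientAddGroup.mk q))) := by
  have hd : (0 : ℝ) < (d : ℝ) + 1 := by positivity
  have hn' : (n : ℝ) ≠ 0 := by positivity
  choose k hk using hs.2
  have hsq : s (embed d ((n * (d + 1)) • (QuotientAddGroup.mk q))) =
      ((d : ℝ) + 1) * ((∑ i, q i * k i : ℤ) : ℝ) := by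
    rw [map_nsmul, map_nsmul, slope_mk, nsmul_eq_mul]
    push_cast
    rw [Finset.mul_sum, Finset.mul_sum]
    refine Finset.sum_congr rfl fun i _ => ?_
    rw [hk]; field_simp
  have hsum : ∑ i, (v + (n * (d + 1)) • q) i = ∑ i, v i + n * (d + 1) * ∑ i, q i := by
    rw [Finset.mul_sum, ← Finset.sum_add_distrib]
    refine Finset.sum_congr rfl fun i _ => ?_
    rw [Pi.add_apply, Pi.smul_apply, nsmul_eq_mul]
    push_cast
    ring
  have e : (s (embed d (QuotientAddGroup.mk (v + (n * (d + 1)) • q))) -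
      (∑ i, v i + n * (d + 1) * ∑ i, q i : ℤ)) / ((d : ℝ) + 1) =
      (s (embed d (QuotientAddGroup.mk v)) - (∑ i, v i : ℤ)) / ((d : ℝ) + 1) +
        ((∑ i, q i * k i - n * ∑ i, q i : ℤ) : ℝ) := by
    rw [QuotientAddGroup.mk_add, QuotientAddGroup.mk_nsmul, map_add, map_add, hsq]
    push_cast
    field_simp
    ring
  rw [floorHeight, floorHeight, hsum, e, Int.floor_add_intCast, hsq]
  push_cast
  ring

theorem nonempty_periodicBC {n : ℕ} (hn : 0 < n) {s : Module.Dual ℝ (H d)}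
    (hs : s ∈ slopesN d n) : (periodicBC (latticeN d n) s).Nonempty := by
  let u : X d → ℤ := fun x => floorHeight s (Quotient.out x)
  have hu : ∀ v : Fin (d + 1) → ℤ, u (QuotientAddGroup.mk v) = floorHeight s v := by
    intro v
    have h : (QuotientAddGroup.mk v : X d) =
        QuotientAddGroup.mk (Quotient.out (QuotientAddGroup.mk v : X d)) :=
      (Quotient.out_eq (QuotientAddGroup.mk v : X d)).symm
    rw [QuotientAddGroup.eq] at h
    obtain ⟨k, hk⟩ := AddSubgroup.mem_zmultiples_iff.mp h
    have : Quotient.out (QuotientAddGroup.mk v : X d) = v + fun _ => k := by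
      have e : (fun _ => k : Fin (d + 1) → ℤ) = k • fun _ => 1 := by funext; simp
      rw [e, hk]; abel
    change floorHeight s (Quotient.out (QuotientAddGroup.mk v : X d)) = _
    rw [this, floorHeight_add_const]
  have h0 : u 0 = 0 := by
    rw [← QuotientAddGroup.mk_zero, hu]
    simp [floorHeight]
  refine ⟨⟨u, by simp [h0], ?_⟩, h0, ?_⟩
  · intro x i
    obtain ⟨v, rfl⟩ := QuotientAddGroup.mk_surjective x
    have e : (QuotientAddGroup.mk v + g i : X d) = QuotientAddGroup.mk (v + Pi.single i 1) := by
      rw [QuotientAddGroup.mk_add, g]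
    rw [e, hu, hu]
    exact floorHeight_add_single hs.1 v i
  · intro x z hz
    obtain ⟨y, rfl⟩ := hz
    obtain ⟨v, rfl⟩ := QuotientAddGroup.mk_surjective x
    obtain ⟨q, rfl⟩ := QuotientAddGroup.mk_surjective y
    rw [nsmulAddMonoidHom_apply]
    simp only
    rw [← QuotientAddGroup.mk_nsmul, ← QuotientAddGroup.mk_add, hu, hu,
      floorHeight_add_smul hn hs, QuotientAddGroup.mk_nsmul]

/-- The mean height under the uniform distribution on periodic height functions is linear. -/
theorem sum_periodicBC {n : ℕ} (hn : 0 < n) (s : Module.Dual ℝ (H d)) (x : X d) :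
    ∑ f ∈ (finite_periodicBC hn s).toFinset, (f x : ℝ) =
      (finite_periodicBC hn s).toFinset.card * s (embed d x) := by
  classical
  set Ω := (finite_periodicBC hn s).toFinset with hΩ
  have hmem : ∀ f, f ∈ Ω ↔ f ∈ periodicBC (latticeN d n) s := fun f => Set.Finite.mem_toFinset _
  set φ : X d → ℝ := fun x => ∑ f ∈ Ω, (f x : ℝ) with hφ
  -- The shift by `v` permutes the periodic functions, which makes the summed height additive. An
  -- additive function is determined by its values on the multiples n(d + 1)x, where periodicity
  -- prescribes it.
  have hadd : ∀ x v, φ (x + v) = φ x + φ v := by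
    intro x v
    have h1 : ∑ f ∈ Ω, ((shift v f) x : ℝ) = φ x := by
      refine Finset.sum_bij (fun f _ => shift v f) ?_ ?_ ?_ ?_
      · intro f hf
        rw [hmem] at hf ⊢
        exact shift_mem_periodicBC hf v
      · intro f _ h _ e
        exact shift_injective v e
      · intro f hf
        rw [hmem] at hf
        exact ⟨shift (-v) f, (hmem _).mpr (shift_mem_periodicBC hf _), shift_shift_neg v f⟩
      · intro f _; rfl
    rw [← h1, hφ]
    simp only
    rw [← Finset.sum_add_distrib]
    refine Finset.sum_congr rfl fun f hf => ?_
    simp [shift, ((hmem f).mp hf).1]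
  let ψ : X d →+ ℝ := AddMonoidHom.mk' φ hadd
  have h1 : φ ((n * (d + 1)) • x) = (n * (d + 1) : ℕ) * φ x := by
    have := map_nsmul ψ (n * (d + 1)) x
    rwa [nsmul_eq_mul] at this
  have h2 : φ ((n * (d + 1)) • x) = Ω.card * s (embed d ((n * (d + 1)) • x)) := by
    rw [hφ]
    simp only
    rw [← nsmul_eq_mul, ← Finset.sum_const]
    refine Finset.sum_congr rfl fun f hf => ?_
    have := ((hmem f).mp hf).2 0 ((n * (d + 1)) • x) ⟨x, rfl⟩
    rwa [zero_add, ((hmem f).mp hf).1, Int.cast_zero, zero_add] at this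
  rw [map_nsmul, map_nsmul, h1, nsmul_eq_mul] at h2
  have h3 : ((n * (d + 1) : ℕ) : ℝ) ≠ 0 := by positivity
  apply mul_left_cancel₀ h3
  linarith

/-- Sub-Gaussian exponential moments of height differences of periodic height functions. -/
theorem sum_exp_periodicBC_le {n : ℕ} (hn : 0 < n) {s : Module.Dual ℝ (H d)}
    (hs : s ∈ slopesN d n) (x y : X d) (l : ℝ) :
    ∑ f ∈ (finite_periodicBC hn s).toFinset,
        Real.exp (l * ((f y : ℝ) - f x - s (embed d (y - x)))) ≤
      (finite_periodicBC hn s).toFinset.card *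
        Real.exp (l ^ 2 * ((d : ℝ) + 1) ^ 2 / 2 * ((graph d).dist x y : ℝ)) := by
  classical
  set Ω := (finite_periodicBC hn s).toFinset with hΩ
  have hmem : ∀ f, f ∈ Ω ↔ f ∈ periodicBC (latticeN d n) s := fun f => Set.Finite.mem_toFinset _
  have h1 : ∑ f ∈ Ω, Real.exp (l * ((f y : ℝ) - f x - s (embed d (y - x)))) =
      ∑ f ∈ Ω, Real.exp (l * ((f (y - x) : ℝ) - s (embed d (y - x)))) := by
    refine Finset.sum_bij (fun f _ => shift x f) ?_ ?_ ?_ ?_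
    · intro f hf
      rw [hmem] at hf ⊢
      exact shift_mem_periodicBC hf x
    · intro f _ h _ e
      exact shift_injective x e
    · intro f hf
      rw [hmem] at hf
      exact ⟨shift (-x) f, (hmem _).mpr (shift_mem_periodicBC hf _), shift_shift_neg x f⟩
    · intro f hf
      simp [shift, ((hmem f).mp hf).1]
  obtain ⟨p, hp⟩ := exists_walk_zero_length_eq_dist x y
  let e : HeightFunction d ↪ (X d → ℤ) := ⟨HeightFunction.toFun, HeightFunction.toFun_injective⟩
  have hcoe : ((Ω.map e : Finset (X d → ℤ)) : Set (X d → ℤ)) =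
      HeightFunction.toFun '' periodicBC (latticeN d n) s := by
    rw [Finset.coe_map, hΩ, Set.Finite.coe_toFinset]; rfl
  have hne : Ω.Nonempty := by
    obtain ⟨f, hf⟩ := nonempty_periodicBC hn hs
    exact ⟨f, (hmem f).mpr hf⟩
  have havg : coordAvg (Ω.map e) (y - x) = s (embed d (y - x)) := by
    rw [coordAvg, Finset.sum_map, Finset.card_map]
    have h2 := sum_periodicBC hn s (y - x)
    have h3 : (Ω.card : ℝ) ≠ 0 := by exact_mod_cast hne.card_pos.ne'
    rw [div_eq_iff h3, mul_comm]
    exact h2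
  have key := IsTranslationLattice.sum_exp_le (D := (d : ℤ) + 1) (by positivity) l p
    (W := Ω.map e) (by rw [hcoe]; exact isTranslationLattice_periodicBC)
    (by
      intro a b hab
      obtain ⟨c, hc⟩ := HeightFunction.sub_eq_or_of_adj hab
      refine ⟨c, fun f hf => ?_⟩
      obtain ⟨f, -, rfl⟩ := Finset.mem_map.mp hf
      exact hc f)
    ⟨0, fun f hf => by
      obtain ⟨f, hf', rfl⟩ := Finset.mem_map.mp hf
      exact ((hmem f).mp hf').1⟩
  rw [havg, Finset.sum_map, Finset.card_map, hp] at key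
  rw [h1]
  push_cast at key
  exact key

end Periodic

/-! ### Local functions and events, and the gradient σ-algebra. -/

section Local

variable {d : ℕ}

theorem measurable_sub (x y : X d) : Measurable fun f : HeightFunction d => f x - f y := by
  rw [measurable_iff_comap_le]
  exact le_iSup₂_of_le (f := fun x y : X d =>
    MeasurableSpace.comap (fun f : HeightFunction d => f x - f y) ⊤) x y le_rfl

theorem measurable_heightFunction {α : Type*} [MeasurableSpace α] {φ : α → HeightFunction d}
    (h : ∀ x y, Measurable fun a => φ a x - φ a y) : Measurable φ := by
  rw [measurable_iff_comap_le]
  change MeasurableSpace.comap φ (⨆ (x : X d) (y : X d),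
    MeasurableSpace.comap (fun f : HeightFunction d => f x - f y) ⊤) ≤ _
  simp only [MeasurableSpace.comap_iSup, MeasurableSpace.comap_comp]
  exact iSup₂_le fun x y => (h x y).comap_le

theorem measurable_shift (v : X d) : Measurable (shift v : HeightFunction d → _) :=
  measurable_heightFunction fun x y => by
    have e : (fun f : HeightFunction d => shift v f x - shift v f y) =
        fun f => f (x + v) - f (y + v) := by
      funext f; simp [shift]
    rw [e]
    exact measurable_sub _ _

/-- `F` depends only on the height differences between vertices of `R` and the origin. -/
def IsLocal {β : Type*} (R : Finset (X d)) (F : HeightFunction d → β) : Prop :=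
  ∀ f h : HeightFunction d, (∀ x ∈ R, f x - f 0 = h x - h 0) → F f = F h

theorem IsLocal.mono {β : Type*} {R R' : Finset (X d)} {F : HeightFunction d → β}
    (hF : IsLocal R F) (h : R ⊆ R') : IsLocal R' F :=
  fun f f' hff' => hF f f' fun x hx => hff' x (h hx)

/-- A local function factors through a map to the countable space `R → ℤ`, in which every set is
measurable. -/
theorem IsLocal.measurable {β : Type*} [MeasurableSpace β] {R : Finset (X d)}
    {F : HeightFunction d → β} (hF : IsLocal R F) : Measurable F := by
  intro t _
  let ρ : HeightFunction d → (R → ℤ) := fun f x => f x - f 0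
  have hρ : Measurable ρ := measurable_pi_iff.mpr fun x => measurable_sub _ _
  have : F ⁻¹' t = ρ ⁻¹' (ρ '' (F ⁻¹' t)) := by
    refine (Set.subset_preimage_image _ _).antisymm ?_
    rintro f ⟨h, hh, e⟩
    have : F h = F f := hF h f fun x hx => congrFun e ⟨x, hx⟩
    change F f ∈ t
    rw [← this]
    exact hh
  rw [this]
  exact hρ (Set.to_countable _).measurableSet

/-- Events that depend on finitely many height differences. -/
def localEvents (d : ℕ) : Set (Set (HeightFunction d)) :=
  {A | ∃ R : Finset (X d), IsLocal R (· ∈ A)}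

theorem measurableSet_of_isLocal {R : Finset (X d)} {A : Set (HeightFunction d)}
    (hA : IsLocal R (· ∈ A)) : MeasurableSet A :=
  measurableSet_setOfPred.mpr hA.measurable

theorem isPiSystem_localEvents : IsPiSystem (localEvents d) := by
  classical
  rintro A ⟨R, hR⟩ B ⟨R', hR'⟩ -
  refine ⟨R ∪ R', fun f h hfh => ?_⟩
  have h1 := hR f h fun x hx => hfh x (Finset.mem_union_left _ hx)
  have h2 := hR' f h fun x hx => hfh x (Finset.mem_union_right _ hx)
  simp only [Set.mem_inter_iff] at h1 h2 ⊢
  rw [h1, h2]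

theorem generateFrom_localEvents :
    gradientField d = MeasurableSpace.generateFrom (localEvents d) := by
  classical
  apply le_antisymm
  · refine iSup₂_le fun x y => ?_
    rintro _ ⟨t, -, rfl⟩
    refine MeasurableSpace.measurableSet_generateFrom ⟨{x, y}, fun f h hfh => ?_⟩
    have h1 := hfh x (by simp)
    have h2 := hfh y (by simp)
    simp only [Set.mem_preimage]
    rw [show f x - f y = h x - h y by linarith]
  · refine MeasurableSpace.generateFrom_le ?_
    rintro A ⟨R, hR⟩
    exact measurableSet_of_isLocal hR

theorem ext_of_localEvents {μ ν : Measure (HeightFunction d)} [IsProbabilityMeasure μ]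
    [IsProbabilityMeasure ν] (h : ∀ R : Finset (X d), ∀ A, IsLocal R (· ∈ A) → μ A = ν A) :
    μ = ν :=
  ext_of_generate_finite _ generateFrom_localEvents isPiSystem_localEvents
    (fun A ⟨R, hR⟩ => h R A hR) (by simp)

/-- The translate of a height function that vanishes at the origin. -/
def normalize (f : HeightFunction d) : HeightFunction d where
  toFun x := f x - f 0
  zero_dvd := by simp
  grad_mem x i := by simpa using f.grad_mem x i

/-- Each generator of the gradient σ-algebra is a preimage under `normalize`, hence so is each
gradient event; and `normalize` is idempotent. -/
theorem normalize_mem_iff {A : Set (HeightFunction d)} (hA : MeasurableSet A)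
    (f : HeightFunction d) : normalize f ∈ A ↔ f ∈ A := by
  have hle : gradientField d ≤ MeasurableSpace.comap normalize ⊤ := by
    refine iSup₂_le fun x y => ?_
    rintro _ ⟨t, -, rfl⟩
    refine ⟨(fun f : HeightFunction d => f x - f y) ⁻¹' t, trivial, ?_⟩
    ext f
    simp [normalize]
  obtain ⟨B, -, rfl⟩ := hle _ hA
  have : normalize (normalize f) = normalize f := by
    apply HeightFunction.toFun_injective
    funext x
    simp [normalize]
  simp [this]

theorem mem_iff_of_measurableSet_fieldOn {R : Set (X d)} {A : Set (HeightFunction d)}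
    (hA : MeasurableSet[fieldOn R] A) {f h : HeightFunction d} (hfh : ∀ x ∈ R, f x = h x) :
    f ∈ A ↔ h ∈ A := by
  have hle : fieldOn R ≤ MeasurableSpace.comap (fun (f : HeightFunction d) (x : R) => f x) ⊤ := by
    refine iSup₂_le fun x hx => ?_
    rintro _ ⟨t, -, rfl⟩
    exact ⟨(fun u : R → ℤ => u ⟨x, hx⟩) ⁻¹' t, trivial, rfl⟩
  obtain ⟨B, -, rfl⟩ := hle _ hA
  have : (fun x : R => f x) = fun x : R => h x := funext fun x => hfh x x.2
  simp only [Set.mem_preimage]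
  rw [this]

/-- This links the σ-algebras in local convergence to local events: normalizing turns dependence on
the values on `R` into dependence on the differences from the value at 0. -/
theorem isLocal_of_measurableSet {R : Finset (X d)} {A : Set (HeightFunction d)}
    (hA : MeasurableSet A) (hR : MeasurableSet[fieldOn (R : Set (X d))] A) :
    IsLocal R (· ∈ A) := by
  intro f h hfh
  simp only [eq_iff_iff]
  rw [← normalize_mem_iff hA f, ← normalize_mem_iff hA h]
  exact mem_iff_of_measurableSet_fieldOn hR fun x hx => hfh x hx

end Local

/-! ### Compactness of pinned height functions and local limits. -/

section Compactness

variable {d : ℕ}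

/-- The space of height functions that vanish at the origin. -/
def pinned (d : ℕ) : Set (X d → ℤ) := {u | IsHeight u ∧ u 0 = 0}

/-- The pinned functions form a closed subset of a product of finite intervals; given u(0) = 0, the
divisibility condition is automatic. -/
theorem isCompact_pinned : IsCompact (pinned d) := by
  choose B hB using exists_forall_abs_sub_le (d := d)
  have hK : IsCompact (Set.univ.pi fun x : X d => Set.Icc (-B x) (B x)) :=
    isCompact_univ_pi fun x => (Set.finite_Icc _ _).isCompact
  refine hK.of_isClosed_subset ?_ ?_
  · have e : pinned d = {u | u 0 = 0} ∩
        ⋂ (x : X d) (i : Fin (d + 1)), {u | u (x + g i) - u x ∈ ({-(d : ℤ), 1} : Set ℤ)} := by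
      ext u
      simp only [pinned, IsHeight, Set.mem_ofPred_eq, Set.mem_inter_iff, Set.mem_iInter,
        Set.mem_insert_iff, Set.mem_singleton_iff]
      constructor
      · rintro ⟨⟨-, h⟩, h0⟩
        exact ⟨h0, h⟩
      · rintro ⟨h0, h⟩
        exact ⟨⟨by simp [h0], h⟩, h0⟩
    rw [e]
    refine IsClosed.inter (isClosed_eq (continuous_apply _) continuous_const)
      (isClosed_iInter fun x => isClosed_iInter fun i => ?_)
    exact (isClosed_discrete ({-(d : ℤ), 1} : Set ℤ)).preimage
      (f := fun u : X d → ℤ => u (x + g i) - u x)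
      ((continuous_apply _).sub (continuous_apply _))
  · intro u hu x _
    have := hB x ⟨u, hu.1.1, hu.1.2⟩
    simp only [hu.2, sub_zero, abs_le] at this
    exact this

instance : Countable (X d) := inferInstanceAs (Countable (Quotient _))

instance : CompactSpace (pinned d) := isCompact_iff_compactSpace.mp isCompact_pinned

/-- Pinned height functions as height functions. -/
def ofPinned (u : pinned d) : HeightFunction d := ⟨u.1, u.2.1.1, u.2.1.2⟩

/-- The pinned height function with the same gradient. -/
def toPinned (f : HeightFunction d) : pinned d :=
  ⟨(normalize f).toFun, (normalize f).isHeight, by simp [normalize]⟩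

theorem measurable_ofPinned : Measurable (ofPinned : pinned d → HeightFunction d) :=
  measurable_heightFunction fun x y =>
    ((measurable_pi_apply x).comp measurable_subtype_coe).sub
      ((measurable_pi_apply y).comp measurable_subtype_coe)

theorem measurable_toPinned : Measurable (toPinned : HeightFunction d → pinned d) :=
  Measurable.subtype_mk (measurable_pi_iff.mpr fun _ => measurable_sub _ _)

theorem IsLocal.continuous_comp_ofPinned {β : Type*} [TopologicalSpace β] {R : Finset (X d)}
    {F : HeightFunction d → β} (hF : IsLocal R F) : Continuous (F ∘ ofPinned) := by
  refine IsLocallyConstant.continuous ((IsLocallyConstant.iff_exists_open _).mpr fun u => ?_)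
  refine ⟨⋂ x ∈ R, {v : pinned d | v.1 x = u.1 x}, ?_, by simp, ?_⟩
  · refine isOpen_biInter_finset fun x _ => ?_
    exact (isOpen_discrete ({u.1 x} : Set ℤ)).preimage (f := fun v : pinned d => v.1 x)
      ((continuous_apply x).comp continuous_subtype_val)
  · intro v hv
    refine hF _ _ fun x hx => ?_
    have := Set.mem_iInter₂.mp hv x hx
    simp only [Set.mem_ofPred_eq] at this
    simp [ofPinned, this, u.2.2, v.2.2]

theorem IsLocal.integral_map_toPinned {R : Finset (X d)} {F : HeightFunction d → ℝ}
    (hF : IsLocal R F) (ν : Measure (HeightFunction d)) :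
    ∫ u, F (ofPinned u) ∂(ν.map toPinned) = ∫ f, F f ∂ν := by
  have hm : Measurable fun u : pinned d => F (ofPinned u) :=
    hF.measurable.comp measurable_ofPinned
  rw [integral_map measurable_toPinned.aemeasurable hm.stronglyMeasurable.aestronglyMeasurable]
  refine integral_congr_ae (Eventually.of_forall fun f => hF _ _ fun x _ => ?_)
  simp [ofPinned, toPinned, normalize]

/-- Sequential compactness of the set of gradient measures for local convergence. -/
theorem exists_local_limit (ν : ℕ → Measure (HeightFunction d))
    [∀ n, IsProbabilityMeasure (ν n)] :
    ∃ μ : Measure (HeightFunction d), IsProbabilityMeasure μ ∧ ∃ k : ℕ → ℕ, StrictMono k ∧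
      ∀ (R : Finset (X d)) (F : HeightFunction d → ℝ), IsLocal R F →
        Tendsto (fun j => ∫ f, F f ∂(ν (k j))) atTop (𝓝 (∫ f, F f ∂μ)) := by
  let ν' : ℕ → ProbabilityMeasure (pinned d) := fun n =>
    ⟨(ν n).map toPinned, Measure.isProbabilityMeasure_map measurable_toPinned.aemeasurable⟩
  -- Probability measures on the compact metrizable space of pinned functions are weakly
  -- sequentially compact. Local functions are locally constant there, hence legitimate test
  -- functions.
  obtain ⟨μ', k, hk, hlim⟩ := CompactSpace.tendsto_subseq ν'
  refine ⟨(μ' : Measure (pinned d)).map ofPinned,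
    Measure.isProbabilityMeasure_map measurable_ofPinned.aemeasurable, k, hk, ?_⟩
  intro R F hF
  have h := ProbabilityMeasure.tendsto_iff_forall_integral_tendsto.mp hlim
    (BoundedContinuousFunction.mkOfCompact ⟨F ∘ ofPinned, hF.continuous_comp_ofPinned⟩)
  rw [integral_map measurable_ofPinned.aemeasurable
    hF.measurable.stronglyMeasurable.aestronglyMeasurable]
  refine Tendsto.congr (fun j => ?_) h
  exact hF.integral_map_toPinned (ν (k j))

/-- Local functions are bounded. -/
theorem IsLocal.exists_bound {R : Finset (X d)} {F : HeightFunction d → ℝ} (hF : IsLocal R F) :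
    ∃ C, ∀ f, ‖F f‖ ≤ C := by
  obtain ⟨C, hC⟩ := (isCompact_range hF.continuous_comp_ofPinned).isBounded.exists_norm_le
  refine ⟨C, fun f => ?_⟩
  have : F (ofPinned (toPinned f)) = F f := hF _ _ fun x _ => by
    simp [ofPinned, toPinned, normalize]
  rw [← this]
  exact hC _ ⟨toPinned f, rfl⟩

theorem IsLocal.integrable {R : Finset (X d)} {F : HeightFunction d → ℝ} (hF : IsLocal R F)
    (μ : Measure (HeightFunction d)) [IsFiniteMeasure μ] : Integrable F μ := by
  obtain ⟨C, hC⟩ := hF.exists_bound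
  exact Integrable.of_bound hF.measurable.stronglyMeasurable.aestronglyMeasurable C
    (Eventually.of_forall hC)

theorem tendsto_measure_of_tendsto_integral {ν : ℕ → Measure (HeightFunction d)}
    [∀ n, IsProbabilityMeasure (ν n)] {μ : Measure (HeightFunction d)} [IsProbabilityMeasure μ]
    (h : ∀ (R : Finset (X d)) (F : HeightFunction d → ℝ), IsLocal R F →
      Tendsto (fun j => ∫ f, F f ∂(ν j)) atTop (𝓝 (∫ f, F f ∂μ)))
    {R : Finset (X d)} {A : Set (HeightFunction d)} (hA : IsLocal R (· ∈ A)) :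
    Tendsto (fun j => ν j A) atTop (𝓝 (μ A)) := by
  classical
  have hm := measurableSet_of_isLocal hA
  have hF : IsLocal R (A.indicator fun _ => (1 : ℝ)) := by
    intro f h hfh
    have := hA f h hfh
    simp only [eq_iff_iff] at this
    simp [Set.indicator_apply, this]
  have h1 := h R _ hF
  simp only [integral_indicator hm, integral_const, smul_eq_mul, mul_one] at h1
  simp only [measureReal_restrict_apply MeasurableSet.univ, Set.univ_inter] at h1
  rw [← ENNReal.tendsto_toReal_iff (fun j => measure_ne_top _ _) (measure_ne_top _ _)]
  exact h1

end Compactness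

/-! ### Uniform measures as counting ratios. -/

section Uniform

variable {d : ℕ}

theorem uniformMeasure_eq {S : Set (HeightFunction d)} (hS : S.Finite) :
    uniformMeasure S =
      (hS.toFinset.card : ℝ≥0∞)⁻¹ • ∑ f ∈ hS.toFinset, Measure.dirac f := by
  have := hS.fintype
  rw [uniformMeasure, Measure.sum_fintype, hS.encard_eq_coe_toFinset_card]
  congr 1
  rw [← Finset.sum_coe_sort hS.toFinset (fun f => Measure.dirac f)]
  exact Fintype.sum_equiv
    (Equiv.subtypeEquivRight (p := (· ∈ S)) (q := (· ∈ hS.toFinset)) fun f => by simp) _ _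
    fun f => rfl

theorem uniformMeasure_apply {S : Set (HeightFunction d)} (hS : S.Finite)
    {A : Set (HeightFunction d)} (hA : MeasurableSet A) :
    uniformMeasure S A = ((S ∩ A).ncard : ℝ≥0∞) / (S.ncard : ℝ≥0∞) := by
  classical
  rw [uniformMeasure_eq hS, Measure.smul_apply, Measure.finsetSum_apply, smul_eq_mul,
    Finset.sum_congr rfl fun f _ => Measure.dirac_apply' f hA]
  rw [div_eq_mul_inv, mul_comm, Set.ncard_eq_toFinset_card S hS,
    Set.ncard_eq_toFinset_card (S ∩ A) (hS.inter_of_left A)]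
  congr 1
  simp only [Set.indicator_apply, Pi.one_apply]
  rw [← Finset.sum_filter]
  simp only [Finset.sum_const, nsmul_eq_mul, mul_one]
  congr 2
  ext f
  simp

theorem isProbabilityMeasure_uniformMeasure {S : Set (HeightFunction d)} (hS : S.Finite)
    (hne : S.Nonempty) : IsProbabilityMeasure (uniformMeasure S) := by
  constructor
  rw [uniformMeasure_apply hS MeasurableSet.univ, Set.inter_univ]
  exact ENNReal.div_self (by simpa using ((Set.ncard_pos hS).mpr hne).ne') (by simp)

theorem integral_uniformMeasure {S : Set (HeightFunction d)} (hS : S.Finite)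
    {F : HeightFunction d → ℝ} (hF : Measurable F) :
    ∫ f, F f ∂(uniformMeasure S) = (∑ f ∈ hS.toFinset, F f) / hS.toFinset.card := by
  rw [uniformMeasure_eq hS, integral_smul_measure, integral_finsetSum_measure]
  · rw [Finset.sum_congr rfl fun f _ => integral_dirac' F f hF.stronglyMeasurable]
    simp [div_eq_inv_mul]
  · intro f _
    exact (integrable_dirac' hF.stronglyMeasurable (by simp))

end Uniform

/-! ### Infinitude of the lattice and injectivity of finite sets into large tori. -/

section Infinite

variable {d : ℕ}

/-- The difference of two coordinates of a representative. -/
def coordDiff (i j : Fin (d + 1)) : X d →+ ℤ :=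
  QuotientAddGroup.lift _
    ((Pi.evalAddMonoidHom (fun _ => ℤ) i) - (Pi.evalAddMonoidHom (fun _ => ℤ) j)) (by
      intro x hx
      obtain ⟨k, rfl⟩ := AddSubgroup.mem_zmultiples_iff.mp hx
      simp)

theorem coordDiff_mk (i j : Fin (d + 1)) (v : Fin (d + 1) → ℤ) :
    coordDiff i j (QuotientAddGroup.mk v) = v i - v j := rfl

theorem exists_coordDiff_ne_zero {x : X d} (hx : x ≠ 0) : ∃ i j, coordDiff i j x ≠ 0 := by
  obtain ⟨v, rfl⟩ := QuotientAddGroup.mk_surjective x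
  by_contra! h
  apply hx
  have : v = fun _ => v 0 := by
    funext i
    have := h i 0
    rw [coordDiff_mk] at this
    linarith
  rw [this, mk_const]

theorem infinite_lattice (hd : 1 ≤ d) : Infinite (X d) := by
  refine Infinite.of_surjective (coordDiff (0 : Fin (d + 1)) (Fin.last d)) fun k => ?_
  refine ⟨QuotientAddGroup.mk (Pi.single 0 k), ?_⟩
  have : Fin.last d ≠ 0 := by
    rw [Ne, Fin.ext_iff, Fin.val_last, Fin.val_zero]; omega
  rw [coordDiff_mk, Pi.single_eq_same, Pi.single_eq_of_ne this, sub_zero]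

/-- Coordinate differences on `latticeN d n` are multiples of n(d + 1), so a fixed nonzero one is
excluded as soon as n exceeds its absolute value. -/
theorem eventually_notMem_latticeN {x : X d} (hx : x ≠ 0) : ∀ᶠ n in atTop, x ∉ latticeN d n := by
  obtain ⟨i, j, hij⟩ := exists_coordDiff_ne_zero hx
  filter_upwards [eventually_gt_atTop (coordDiff i j x).natAbs] with n hn
  rintro ⟨y, rfl⟩
  rw [nsmulAddMonoidHom_apply, map_nsmul, nsmul_eq_mul] at hij hn
  rw [Int.natAbs_mul, Int.natAbs_natCast] at hn
  have h1 : 0 < (coordDiff i j y).natAbs := by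
    rw [Int.natAbs_pos]; rintro h; simp [h] at hij
  have : n * (d + 1) * 1 ≤ n * (d + 1) * (coordDiff i j y).natAbs := Nat.mul_le_mul_left _ h1
  nlinarith

/-- Finite sets inject into the torus `X / L_n` for large `n`. -/
theorem eventually_injOn_latticeN (T : Finset (X d)) :
    ∀ᶠ n in atTop, ∀ p ∈ T, ∀ q ∈ T, p - q ∈ latticeN d n → p = q := by
  rw [Filter.eventually_all_finset]
  intro p _
  rw [Filter.eventually_all_finset]
  intro q _
  by_cases h : p = q
  · exact Eventually.of_forall fun _ _ => h
  · filter_upwards [eventually_notMem_latticeN (sub_ne_zero.mpr h)] with n hn h'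
    exact absurd h' hn

end Infinite

/-! ### Locality of the fixed-boundary kernel. -/

section Transplant

variable {d : ℕ}

/-- `T` contains `R`, its neighbours, and the origin. -/
structure IsCollar (R : Set (X d)) (T : Finset (X d)) : Prop where
  subset : ∀ r ∈ R, r ∈ T
  add_mem : ∀ r ∈ R, ∀ i, r + g i ∈ T
  sub_mem : ∀ r ∈ R, ∀ i, r - g i ∈ T
  zero_mem : 0 ∈ T

theorem exists_isCollar {R : Set (X d)} (hR : R.Finite) (T₀ : Finset (X d)) :
    ∃ T, IsCollar R T ∧ T₀ ⊆ T := by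
  classical
  set R' := hR.toFinset
  have hR' : ∀ r ∈ R, r ∈ R' := fun r hr => hR.mem_toFinset.mpr hr
  refine ⟨T₀ ∪ (R' ∪ ((R' ×ˢ Finset.univ).image (fun p => p.1 + g p.2) ∪
    ((R' ×ˢ Finset.univ).image (fun p => p.1 - g p.2) ∪ {0}))), ⟨?_, ?_, ?_, ?_⟩,
    Finset.subset_union_left⟩
  · intro r hr
    simp [hR' r hr]
  · intro r hr i
    refine Finset.mem_union_right _ (Finset.mem_union_right _ (Finset.mem_union_left _ ?_))
    exact Finset.mem_image.mpr ⟨(r, i), by simp [hR' r hr], rfl⟩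
  · intro r hr i
    refine Finset.mem_union_right _ (Finset.mem_union_right _ (Finset.mem_union_right _
      (Finset.mem_union_left _ ?_)))
    exact Finset.mem_image.mpr ⟨(r, i), by simp [hR' r hr], rfl⟩
  · simp

/-- A collar contains both ends of every edge that meets `R`. Each edge therefore sees either `h₁ +
c` alone or `h₂` alone. -/
theorem isHeight_of_local {u : X d → ℤ} {R : Set (X d)} {T : Finset (X d)} (hT : IsCollar R T)
    (h₁ h₂ : HeightFunction d) {c : ℤ} (hdvd : ((d : ℤ) + 1) ∣ c)
    (hu₁ : ∀ x ∈ T, u x = h₁ x + c) (hu₂ : ∀ x ∉ R, u x = h₂ x) : IsHeight u := by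
  refine ⟨?_, fun x i => ?_⟩
  · rw [hu₁ 0 hT.zero_mem]
    exact dvd_add h₁.zero_dvd hdvd
  · by_cases hx : x ∈ R
    · rw [hu₁ _ (hT.subset x hx), hu₁ _ (hT.add_mem x hx i)]
      simpa using h₁.grad_mem x i
    · by_cases hx' : x + g i ∈ R
      · have := hT.sub_mem _ hx' i
        rw [add_sub_cancel_right] at this
        rw [hu₁ _ this, hu₁ _ (hT.subset _ hx')]
        simpa using h₁.grad_mem x i
      · rw [hu₂ x hx, hu₂ _ hx']
        exact h₂.grad_mem x i

/-- A height function `h` can be glued, after adding a constant, into a height function `f'` with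
the same gradient near the boundary of `R`. -/
theorem exists_transplant {R : Set (X d)} {T : Finset (X d)} (hT : IsCollar R T)
    (h f' : HeightFunction d) {c : ℤ} (hdvd : ((d : ℤ) + 1) ∣ c)
    (hc : ∀ x ∈ T, x ∉ R → f' x = h x + c) :
    ∃ h' ∈ fixedBC R f', ∀ x ∈ T, h' x = h x + c := by
  classical
  let u : X d → ℤ := fun x => if x ∈ R then h x + c else f' x
  have h1 : ∀ x ∈ T, u x = h x + c := by
    intro x hx
    by_cases hR : x ∈ R
    · simp [u, hR]
    · simp [u, hR, hc x hx hR]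
  have h2 : ∀ x ∉ R, u x = f' x := by
    intro x hx
    simp [u, hx]
  have hu := isHeight_of_local hT h f' hdvd h1 h2
  exact ⟨⟨u, hu.1, hu.2⟩, h2, h1⟩

/-- The vertex `z` off `R` fixes the additive constant; without it there would be infinitely many
translates. -/
theorem finite_fixedBC {R : Set (X d)} (hR : R.Finite) {z : X d} (hz : z ∉ R)
    (f : HeightFunction d) : (fixedBC R f).Finite := by
  choose B hB using exists_forall_abs_sub_le (d := d)
  have := hR.to_subtype
  have := Fintype.ofFinite R
  refine Set.Finite.of_finite_image
    (f := fun h : HeightFunction d => fun x : R => h x) ?_ ?_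
  · refine (Set.finite_Icc (fun x : R => f z - B z - B x) (fun x : R => f z + B z + B x)).subset ?_
    rintro _ ⟨h, hh, rfl⟩
    have key : ∀ x : R, f z - B z - B x ≤ h x ∧ h x ≤ f z + B z + B x := by
      intro x
      have h1 := abs_le.mp (hB z h)
      have h2 := abs_le.mp (hB x h)
      have h3 := hh z hz
      constructor <;> linarith
    exact ⟨fun x => (key x).1, fun x => (key x).2⟩
  · intro h hh h' hh' e
    apply HeightFunction.toFun_injective
    funext x
    by_cases hx : x ∈ R
    · exact congrFun e ⟨x, hx⟩
    · rw [hh x hx, hh' x hx]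

/-- Transplant the configuration on `R` from the boundary condition `f` to `f'`. Only a constant is
added on the collar, so the local event `A` is preserved and the map is injective. -/
theorem ncard_fixedBC_inter_le {R : Set (X d)} {T : Finset (X d)} (hT : IsCollar R T) {z : X d}
    (hz : z ∉ R) {A : Set (HeightFunction d)} (hA : IsLocal T (· ∈ A)) {f f' : HeightFunction d}
    (hff' : ∀ x ∈ T, f x - f 0 = f' x - f' 0) :
    (fixedBC R f ∩ A).ncard ≤ (fixedBC R f' ∩ A).ncard := by
  have hR : R.Finite := T.finite_toSet.subset hT.subset
  have H : ∀ h : HeightFunction d, h ∈ fixedBC R f → ∃ h' ∈ fixedBC R f',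
      ∀ x ∈ T, h' x = h x + (f' 0 - f 0) := fun h hh =>
    exists_transplant hT h f' (_root_.dvd_sub f'.zero_dvd f.zero_dvd) fun x hx hxR => by
      rw [hh x hxR]; linarith [hff' x hx]
  choose! φ hφ hφ' using H
  refine Set.ncard_le_ncard_of_injOn φ ?_ ?_ ((finite_fixedBC hR hz f').inter_of_left A)
  · rintro h ⟨hh, hhA⟩
    refine ⟨hφ h hh, ?_⟩
    have := hA (φ h) h fun x hx => by
      rw [hφ' h hh x hx, hφ' h hh 0 hT.zero_mem]; ring
    simp only [eq_iff_iff] at this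
    exact this.mpr hhA
  · rintro h ⟨hh, -⟩ h' ⟨hh', -⟩ e
    apply HeightFunction.toFun_injective
    funext x
    by_cases hx : x ∈ R
    · have h1 := hφ' h hh x (hT.subset x hx)
      have h2 := hφ' h' hh' x (hT.subset x hx)
      rw [e] at h1
      linarith
    · rw [hh x hx, hh' x hx]

theorem ncard_fixedBC_inter_eq {R : Set (X d)} {T : Finset (X d)} (hT : IsCollar R T) {z : X d}
    (hz : z ∉ R) {A : Set (HeightFunction d)} (hA : IsLocal T (· ∈ A)) {f f' : HeightFunction d}
    (hff' : ∀ x ∈ T, f x - f 0 = f' x - f' 0) :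
    (fixedBC R f ∩ A).ncard = (fixedBC R f' ∩ A).ncard :=
  (ncard_fixedBC_inter_le hT hz hA hff').antisymm
    (ncard_fixedBC_inter_le hT hz hA fun x hx => (hff' x hx).symm)

theorem uniformMeasure_fixedBC_apply {R : Set (X d)} (hR : R.Finite) {z : X d} (hz : z ∉ R)
    (f : HeightFunction d) {A : Set (HeightFunction d)} (hA : MeasurableSet A) :
    uniformMeasure (fixedBC R f) A =
      ((fixedBC R f ∩ A).ncard : ℝ≥0∞) / ((fixedBC R f).ncard : ℝ≥0∞) :=
  uniformMeasure_apply (finite_fixedBC hR hz f) hA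

theorem isLocal_uniformMeasure_fixedBC {R : Set (X d)} {T : Finset (X d)} (hT : IsCollar R T)
    {z : X d} (hz : z ∉ R) {A : Set (HeightFunction d)} (hA : IsLocal T (· ∈ A)) :
    IsLocal T fun f => uniformMeasure (fixedBC R f) A := by
  intro f f' hff'
  have hR : R.Finite := T.finite_toSet.subset hT.subset
  have hm := measurableSet_of_isLocal hA
  simp only [uniformMeasure_fixedBC_apply hR hz _ hm]
  have h1 := ncard_fixedBC_inter_eq hT hz hA hff'
  have h2 := ncard_fixedBC_inter_eq hT hz (A := Set.univ) (fun _ _ _ => rfl) hff'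
  simp only [Set.inter_univ] at h2
  rw [h1, h2]

end Transplant

/-! ### The DLR equation for periodic measures on large tori. -/

section Periodization

variable {d : ℕ} {L : AddSubgroup (X d)} {s : Module.Dual ℝ (H d)}

theorem periodic_add {f : HeightFunction d} (hf : f ∈ periodicBC L s) (x : X d) {y : X d}
    (hy : y ∈ L) : f (x + y) = f x + f y := by
  have h1 := hf.2 x y hy
  have h2 := hf.2 0 y hy
  rw [hf.1, zero_add] at h2
  rw [Int.cast_zero, zero_add] at h2
  rw [← h2] at h1
  exact_mod_cast h1

/-- The periodic height functions that have the gradient of `f` outside `R + L`. -/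
def periodicClass (L : AddSubgroup (X d)) (s : Module.Dual ℝ (H d)) (R : Set (X d)) (z : X d)
    (f : HeightFunction d) : Set (HeightFunction d) :=
  {f' | f' ∈ periodicBC L s ∧ ∀ x, (∀ y ∈ L, x + y ∉ R) → f' x - f' z = f x - f z}

theorem notMem_add_of_mem {R : Set (X d)} {T : Finset (X d)} (hT : IsCollar R T)
    (hinj : ∀ p ∈ T, ∀ q ∈ T, p - q ∈ L → p = q) {x : X d} (hx : x ∈ T) (hxR : x ∉ R) :
    ∀ y ∈ L, x + y ∉ R := by
  intro y hy h
  have := hinj _ (hT.subset _ h) x hx (by simpa using hy)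
  rw [this] at h
  exact hxR h

/-- Cut out the part of a periodic function on `R` and glue it into `f`. Periodicity recovers the
function from its gradient on `R` and the common gradient off the translates. The anchor is `z`
because the origin may lie in `R`. -/
theorem ncard_periodicClass_inter_le {R : Set (X d)} {T : Finset (X d)} (hT : IsCollar R T)
    (hinj : ∀ p ∈ T, ∀ q ∈ T, p - q ∈ L → p = q) {z : X d} (hz : z ∉ R)
    {A : Set (HeightFunction d)} (hA : IsLocal T (· ∈ A)) {f : HeightFunction d} :
    (periodicClass L s R z f ∩ A).ncard ≤ (fixedBC R f ∩ A).ncard := by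
  have hR : R.Finite := T.finite_toSet.subset hT.subset
  have H : ∀ f' : HeightFunction d, f' ∈ periodicClass L s R z f → ∃ h ∈ fixedBC R f,
      ∀ x ∈ T, h x = f' x + (f z - f' z) := fun f' hf' =>
    exists_transplant hT f' f (f.isHeight.dvd_sub f'.isHeight z) fun x hx hxR => by
      linarith [hf'.2 x (notMem_add_of_mem hT hinj hx hxR)]
  choose! φ hφ hφ' using H
  refine Set.ncard_le_ncard_of_injOn φ ?_ ?_ ((finite_fixedBC hR hz f).inter_of_left A)
  · rintro h ⟨hh, hhA⟩
    refine ⟨hφ h hh, ?_⟩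
    have := hA (φ h) h fun x hx => by
      rw [hφ' h hh x hx, hφ' h hh 0 hT.zero_mem]; ring
    simp only [eq_iff_iff] at this
    exact this.mpr hhA
  · rintro f₁ ⟨hf₁, -⟩ f₂ ⟨hf₂, -⟩ e
    have key : ∀ x, f₁ x - f₁ z = f₂ x - f₂ z := by
      intro x
      by_cases hx : ∀ y ∈ L, x + y ∉ R
      · rw [hf₁.2 x hx, hf₂.2 x hx]
      · push Not at hx
        obtain ⟨y, hy, hxy⟩ := hx
        have h1 := hφ' f₁ hf₁ _ (hT.subset _ hxy)
        have h2 := hφ' f₂ hf₂ _ (hT.subset _ hxy)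
        rw [e] at h1
        have h3 := hf₁.1.2 x y hy
        have h4 := hf₂.1.2 x y hy
        have h5 : ((f₁ (x + y) : ℤ) : ℝ) - f₁ z = f₂ (x + y) - f₂ z := by
          have : f₁ (x + y) - f₁ z = f₂ (x + y) - f₂ z := by linarith
          exact_mod_cast this
        have h6 : ((f₁ x : ℤ) : ℝ) - f₁ z = f₂ x - f₂ z := by linarith
        exact_mod_cast h6
    apply HeightFunction.toFun_injective
    funext x
    have h0 := key 0
    have h1 := key x
    rw [hf₁.1.1, hf₂.1.1] at h0
    linarith

/-- A change of a periodic height function `f` on `R` can be repeated periodically. -/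
theorem exists_periodization {R : Set (X d)} {T : Finset (X d)} (hT : IsCollar R T)
    (hinj : ∀ p ∈ T, ∀ q ∈ T, p - q ∈ L → p = q) {z : X d} (hz : z ∉ R) (hzT : z ∈ T)
    {f h : HeightFunction d} (hf : f ∈ periodicBC L s) (hh : h ∈ fixedBC R f) :
    ∃ f' ∈ periodicClass L s R z f, ∃ c, ∀ x ∈ T, f' x = h x - c := by
  classical
  -- The change `h - f` on `R`, extended periodically. The chosen representative is unique because
  -- `T` injects into the torus.
  let δ : X d → ℤ := fun x =>
    if hx : ∃ r ∈ R, x - r ∈ L then h hx.choose - f hx.choose else 0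
  have hδ : ∀ p ∈ T, ∀ x, x - p ∈ L → δ x = h p - f p := by
    intro p hp x hxp
    by_cases hx : ∃ r ∈ R, x - r ∈ L
    · have e : hx.choose = p := by
        refine hinj _ (hT.subset _ hx.choose_spec.1) p hp ?_
        have := L.sub_mem hxp hx.choose_spec.2
        rwa [sub_sub_sub_cancel_left] at this
      simp only [δ, hx, dif_pos]
      rw [e]
    · have : p ∉ R := fun hpR => hx ⟨p, hpR, hxp⟩
      simp [δ, hx, hh p this]
  have hδ0 : ∀ x, (∀ y ∈ L, x + y ∉ R) → δ x = 0 := by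
    intro x hx
    have : ¬ ∃ r ∈ R, x - r ∈ L := by
      rintro ⟨r, hr, hxr⟩
      refine hx (-(x - r)) (L.neg_mem hxr) ?_
      simpa using hr
    simp [δ, this]
  have hδper : ∀ x, ∀ y ∈ L, δ (x + y) = δ x := by
    intro x y hy
    by_cases hx : ∃ r ∈ R, x - r ∈ L
    · obtain ⟨r, hr, hxr⟩ := hx
      rw [hδ r (hT.subset r hr) x hxr, hδ r (hT.subset r hr) (x + y)]
      rw [add_sub_right_comm]
      exact L.add_mem hxr hy
    · rw [hδ0 x, hδ0 (x + y)]
      · intro y' hy' hmem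
        refine hx ⟨_, hmem, ?_⟩
        rw [show x - (x + y + y') = -(y + y') by abel]
        exact L.neg_mem (L.add_mem hy hy')
      · intro y' hy' hmem
        refine hx ⟨_, hmem, ?_⟩
        simpa using hy'
  have hsub : ∀ x r : X d, ∀ i, x - r ∈ L → f (x + g i) - f x = f (r + g i) - f r := by
    intro x r i hxr
    have h1 := periodic_add hf r hxr
    have h2 := periodic_add hf (r + g i) hxr
    rw [add_sub_cancel] at h1
    rw [show r + g i + (x - r) = x + g i by abel] at h2
    linarith
  have hgrad : ∀ x i, f (x + g i) + δ (x + g i) - (f x + δ x) = -(d : ℤ) ∨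
      f (x + g i) + δ (x + g i) - (f x + δ x) = 1 := by
    intro x i
    have aux : ∀ r, r ∈ T → r + g i ∈ T → x - r ∈ L →
        f (x + g i) + δ (x + g i) - (f x + δ x) = -(d : ℤ) ∨
          f (x + g i) + δ (x + g i) - (f x + δ x) = 1 := by
      intro r hr hr' hxr
      have h1 := hδ r hr x hxr
      have h2 := hδ (r + g i) hr' (x + g i) (by rwa [add_sub_add_right_eq_sub])
      have h3 := hsub x r i hxr
      have h4 := h.grad_mem r i
      rw [show f (x + g i) + δ (x + g i) - (f x + δ x) = h (r + g i) - h r by linarith]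
      exact h4
    by_cases hx : ∃ r ∈ R, x - r ∈ L
    · obtain ⟨r, hr, hxr⟩ := hx
      exact aux r (hT.subset r hr) (hT.add_mem r hr i) hxr
    by_cases hx' : ∃ r ∈ R, x + g i - r ∈ L
    · obtain ⟨r, hr, hxr⟩ := hx'
      refine aux (r - g i) (hT.sub_mem r hr i) (by simpa using hT.subset r hr) ?_
      rwa [sub_sub_eq_add_sub]
    have e1 : δ x = 0 := by simp [δ, hx]
    have e2 : δ (x + g i) = 0 := by simp [δ, hx']
    rw [e1, e2]
    simpa using f.grad_mem x i
  have hzL := notMem_add_of_mem hT hinj hzT hz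
  -- Subtracting `δ 0` restores the value 0 at the origin, which the change may have moved.
  refine ⟨⟨fun x => f x + δ x - δ 0, by simp [hf.1], fun x i => ?_⟩, ⟨⟨by simp [hf.1], ?_⟩, ?_⟩,
    δ 0, ?_⟩
  · have := hgrad x i
    rwa [sub_sub_sub_cancel_right]
  · intro x y hy
    have h1 := hf.2 x y hy
    simp only [hδper x y hy]
    push_cast
    rw [h1]
    ring
  · intro x hx
    simp only [hδ0 x hx, hδ0 z hzL]
    ring
  · intro x hx
    simp only
    rw [hδ x hx x (by simp [L.zero_mem])]
    ring

/-- Periodization is injective: the constant it subtracts can be read off at `z`, where the boundary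
condition fixes the height, and then the values on `R` are recovered. -/
theorem ncard_fixedBC_inter_le_ncard_periodicClass {R : Set (X d)} {T : Finset (X d)}
    (hT : IsCollar R T) (hfin : (periodicBC L s).Finite)
    (hinj : ∀ p ∈ T, ∀ q ∈ T, p - q ∈ L → p = q) {z : X d} (hz : z ∉ R) (hzT : z ∈ T)
    {A : Set (HeightFunction d)} (hA : IsLocal T (· ∈ A)) {f : HeightFunction d}
    (hf : f ∈ periodicBC L s) :
    (fixedBC R f ∩ A).ncard ≤ (periodicClass L s R z f ∩ A).ncard := by
  have H : ∀ h : HeightFunction d, h ∈ fixedBC R f → ∃ f' ∈ periodicClass L s R z f,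
      ∃ c, ∀ x ∈ T, f' x = h x - c := fun h hh => exists_periodization hT hinj hz hzT hf hh
  choose! φ hφ c hc using H
  refine Set.ncard_le_ncard_of_injOn φ ?_ ?_
    ((hfin.subset fun f' hf' => hf'.1).inter_of_left A)
  · rintro h ⟨hh, hhA⟩
    refine ⟨hφ h hh, ?_⟩
    have := hA (φ h) h fun x hx => by
      rw [hc h hh x hx, hc h hh 0 hT.zero_mem]; ring
    simp only [eq_iff_iff] at this
    exact this.mpr hhA
  · rintro h ⟨hh, -⟩ h' ⟨hh', -⟩ e
    apply HeightFunction.toFun_injective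
    funext x
    by_cases hx : x ∈ R
    · have h1 := hc h hh x (hT.subset x hx)
      have h2 := hc h' hh' x (hT.subset x hx)
      have h3 := hc h hh z hzT
      have h4 := hc h' hh' z hzT
      rw [e] at h1 h3
      rw [hh z hz] at h3
      rw [hh' z hz] at h4
      linarith
    · rw [hh x hx, hh' x hx]

theorem ncard_fixedBC_inter_eq_ncard_periodicClass {R : Set (X d)} {T : Finset (X d)}
    (hT : IsCollar R T) (hfin : (periodicBC L s).Finite)
    (hinj : ∀ p ∈ T, ∀ q ∈ T, p - q ∈ L → p = q) {z : X d} (hz : z ∉ R) (hzT : z ∈ T)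
    {A : Set (HeightFunction d)} (hA : IsLocal T (· ∈ A)) {f : HeightFunction d}
    (hf : f ∈ periodicBC L s) :
    (fixedBC R f ∩ A).ncard = (periodicClass L s R z f ∩ A).ncard :=
  (ncard_fixedBC_inter_le_ncard_periodicClass hT hfin hinj hz hzT hA hf).antisymm
    (ncard_periodicClass_inter_le hT hinj hz hA)

/-- Averaging the conditional frequencies of `p` over the classes of an equivalence relation. -/
theorem sum_card_filter_div_card {α : Type*} (Ω : Finset α) {r : α → α → Prop}
    (hr : Equivalence r) (p : α → Prop) [DecidableRel r] [DecidablePred p] :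
    ∑ a ∈ Ω, ((Ω.filter fun b => r a b ∧ p b).card : ℝ) / (Ω.filter fun b => r a b).card =
      (Ω.filter p).card := by
  classical
  have hcls : ∀ a b, r a b → (Ω.filter fun c => r a c) = Ω.filter fun c => r b c := by
    intro a b hab
    refine Finset.filter_congr fun c _ => ⟨fun h => hr.trans (hr.symm hab) h, fun h => hr.trans hab h⟩
  -- Class sizes are constant on classes. After exchanging the sums, each `b` with `p b` receives
  -- the inverse class size once from each member of its class, in total 1.
  have h1 : ∀ a ∈ Ω, ((Ω.filter fun b => r a b ∧ p b).card : ℝ) / (Ω.filter fun b => r a b).card =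
      ∑ b ∈ Ω, if r b a ∧ p b then ((Ω.filter fun c => r b c).card : ℝ)⁻¹ else 0 := by
    intro a _
    rw [← Finset.sum_filter, div_eq_mul_inv]
    rw [Finset.sum_congr rfl (g := fun _ => ((Ω.filter fun c => r a c).card : ℝ)⁻¹)]
    · rw [Finset.sum_const, nsmul_eq_mul]
      congr 3
      refine Finset.filter_congr fun b _ => ⟨fun h => ⟨hr.symm h.1, h.2⟩, fun h => ⟨hr.symm h.1, h.2⟩⟩
    · intro b hb
      rw [hcls b a (Finset.mem_filter.mp hb).2.1]
  rw [Finset.sum_congr rfl h1, Finset.sum_comm, Finset.card_filter, Nat.cast_sum]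
  refine Finset.sum_congr rfl fun b hb => ?_
  by_cases hp : p b
  · simp only [hp, and_true, if_true, Nat.cast_one]
    rw [← Finset.sum_filter, Finset.sum_const, nsmul_eq_mul]
    refine mul_inv_cancel₀ ?_
    have : 0 < (Ω.filter fun c => r b c).card :=
      Finset.card_pos.mpr ⟨b, Finset.mem_filter.mpr ⟨hb, hr.refl b⟩⟩
    exact_mod_cast this.ne'
  · simp [hp]

/-- The DLR equation for periodic height functions and local events. -/
theorem integral_uniformMeasure_fixedBC_periodicBC {R : Set (X d)} {T : Finset (X d)}
    (hT : IsCollar R T) (hfin : (periodicBC L s).Finite)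
    (hinj : ∀ p ∈ T, ∀ q ∈ T, p - q ∈ L → p = q) {z : X d} (hz : z ∉ R) (hzT : z ∈ T)
    {A : Set (HeightFunction d)} (hA : IsLocal T (· ∈ A)) :
    ∫ f, (uniformMeasure (fixedBC R f) A).toReal ∂(uniformMeasure (periodicBC L s)) =
      (uniformMeasure (periodicBC L s)).real A := by
  classical
  have hR : R.Finite := T.finite_toSet.subset hT.subset
  have hm := measurableSet_of_isLocal hA
  have hloc : IsLocal T fun f => (uniformMeasure (fixedBC R f) A).toReal := fun f f' h =>
    congrArg ENNReal.toReal (isLocal_uniformMeasure_fixedBC hT hz hA f f' h)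
  rw [integral_uniformMeasure hfin hloc.measurable, Measure.real,
    uniformMeasure_apply hfin hm, ENNReal.toReal_div, ENNReal.toReal_natCast,
    ENNReal.toReal_natCast, Set.ncard_eq_toFinset_card _ hfin,
    Set.ncard_eq_toFinset_card _ (hfin.inter_of_left A)]
  congr 1
  set Ω := hfin.toFinset with hΩ
  set r : HeightFunction d → HeightFunction d → Prop := fun f f' =>
    ∀ x, (∀ y ∈ L, x + y ∉ R) → f' x - f' z = f x - f z with hr
  have hequiv : Equivalence r :=
    ⟨fun f x _ => rfl, fun h x hx => (h x hx).symm, fun h h' x hx => (h' x hx).trans (h x hx)⟩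
  -- The kernel is the conditional frequency of `A` in the class of `f`; taking the whole space for
  -- the event gives the denominator.
  have hcard : ∀ f ∈ Ω, (uniformMeasure (fixedBC R f) A).toReal =
      ((Ω.filter fun b => r f b ∧ b ∈ A).card : ℝ) / (Ω.filter fun b => r f b).card := by
    intro f hf
    have hf' : f ∈ periodicBC L s := hfin.mem_toFinset.mp hf
    have h1 := ncard_fixedBC_inter_eq_ncard_periodicClass hT hfin hinj hz hzT hA hf'
    have h2 := ncard_fixedBC_inter_eq_ncard_periodicClass hT hfin hinj hz hzT
      (A := Set.univ) (fun _ _ _ => rfl) hf'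
    simp only [Set.inter_univ] at h2
    rw [uniformMeasure_fixedBC_apply hR hz f hm, h1, h2, ENNReal.toReal_div,
      ENNReal.toReal_natCast, ENNReal.toReal_natCast, ← Set.ncard_coe_finset,
      ← Set.ncard_coe_finset]
    congr 3
    · ext b
      simp only [periodicClass, hr, hΩ, Set.mem_inter_iff, Set.mem_ofPred_eq, Finset.coe_filter,
        Set.Finite.mem_toFinset, and_assoc]
    · ext b
      simp [hΩ, periodicClass, hr]
  rw [Finset.sum_congr rfl hcard, sum_card_filter_div_card Ω hequiv (· ∈ A)]
  congr 2
  ext b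
  simp [hΩ]

end Periodization

/-! ### Reduction of the DLR equation to local events. -/

section Gibbs

variable {d : ℕ}

theorem isProbabilityMeasure_fixedBC {R : Set (X d)} (hR : R.Finite) {z : X d} (hz : z ∉ R)
    (f : HeightFunction d) : IsProbabilityMeasure (uniformMeasure (fixedBC R f)) :=
  isProbabilityMeasure_uniformMeasure (finite_fixedBC hR hz f) ⟨f, fun _ _ => rfl⟩

theorem measurable_uniformMeasure_fixedBC {R : Set (X d)} (hR : R.Finite) {z : X d} (hz : z ∉ R) :
    Measurable fun f : HeightFunction d => uniformMeasure (fixedBC R f) := by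
  have := fun f => isProbabilityMeasure_fixedBC hR hz f
  refine Measurable.measure_of_isPiSystem_of_isProbabilityMeasure generateFrom_localEvents
    isPiSystem_localEvents ?_
  rintro A ⟨T₀, hA⟩
  obtain ⟨T, hT, hsub⟩ := exists_isCollar hR T₀
  exact (isLocal_uniformMeasure_fixedBC hT hz (hA.mono hsub)).measurable

/-- It suffices to verify the DLR equation for local events. -/
theorem isGradientGibbs_of_local (hd : 1 ≤ d) {μ : Measure (HeightFunction d)}
    [IsProbabilityMeasure μ]
    (h : ∀ (R : Set (X d)) (T : Finset (X d)) (z : X d) (A : Set (HeightFunction d)),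
      IsCollar R T → z ∉ R → z ∈ T → IsLocal T (· ∈ A) →
      ∫ f, (uniformMeasure (fixedBC R f) A).toReal ∂μ = μ.real A) :
    IsGradientGibbs μ := by
  classical
  intro R hR A hA
  have := infinite_lattice hd
  obtain ⟨z, hz⟩ := hR.exists_notMem
  have hprob := fun f => isProbabilityMeasure_fixedBC hR hz f
  have hmeas := measurable_uniformMeasure_fixedBC hR hz
  rw [← Measure.bind_apply hA hmeas.aemeasurable]
  have hb : IsProbabilityMeasure (μ.bind fun f => uniformMeasure (fixedBC R f)) := by
    constructor
    rw [Measure.bind_apply MeasurableSet.univ hmeas.aemeasurable]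
    simp
  have : μ = μ.bind fun f => uniformMeasure (fixedBC R f) := by
    refine ext_of_localEvents fun T₀ B hB => ?_
    obtain ⟨T, hT, hsub⟩ := exists_isCollar hR (insert z T₀)
    have hB' := hB.mono ((Finset.subset_insert z T₀).trans hsub)
    have hm := measurableSet_of_isLocal hB'
    rw [Measure.bind_apply hm hmeas.aemeasurable]
    have key := h R T z B hT hz (hsub (Finset.mem_insert_self _ _)) hB'
    have hmB : Measurable fun f : HeightFunction d => uniformMeasure (fixedBC R f) B :=
      (Measure.measurable_coe hm).comp hmeas
    rw [integral_toReal hmB.aemeasurable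
      (Eventually.of_forall fun f => measure_lt_top _ _)] at key
    have hle : ∫⁻ f, uniformMeasure (fixedBC R f) B ∂μ ≤ 1 := by
      calc _ ≤ ∫⁻ _, 1 ∂μ := lintegral_mono fun f => prob_le_one
        _ = 1 := by simp
    exact ((ENNReal.toReal_eq_toReal_iff' (hle.trans_lt ENNReal.one_lt_top).ne
      (measure_ne_top _ _)).mp key).symm
  exact congrFun (congrArg (fun m : Measure (HeightFunction d) => (m : Set _ → ℝ≥0∞)) this) A

end Gibbs

/-! ### Approximation by rational slopes. -/

section Slopes

variable {d : ℕ}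

/-- The linear functional on `H` with given coefficients. -/
def coeffDual (a : Fin (d + 1) → ℝ) : Module.Dual ℝ (H d) :=
  (∑ i, a i • LinearMap.proj i) ∘ₗ (H d).subtype

theorem coeffDual_apply (a : Fin (d + 1) → ℝ) (v : H d) :
    coeffDual a v = ∑ i, a i * (v : Fin (d + 1) → ℝ) i := by
  simp [coeffDual]

theorem embed_g_apply (i j : Fin (d + 1)) :
    (embed d (g i) : Fin (d + 1) → ℝ) j = (if j = i then 1 else 0) - 1 / ((d : ℝ) + 1) := by
  change ((Pi.single i (1 : ℤ) : Fin (d + 1) → ℤ) j : ℝ) -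
    (∑ k, ((Pi.single i (1 : ℤ) : Fin (d + 1) → ℤ) k : ℝ)) / (d + 1) = _
  rw [← Int.cast_sum, Finset.sum_pi_single', Pi.single_apply]
  simp

theorem coeffDual_embed_g {a : Fin (d + 1) → ℝ} (ha : ∑ i, a i = 0) (i : Fin (d + 1)) :
    coeffDual a (embed d (g i)) = a i := by
  simp only [coeffDual_apply, embed_g_apply, mul_sub, Finset.sum_sub_distrib, ← Finset.sum_mul, ha]
  simp

theorem coeffDual_slope (s : Module.Dual ℝ (H d)) :
    coeffDual (fun i => s (embed d (g i))) = s := by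
  ext v
  have hv : v = ∑ i, (v : Fin (d + 1) → ℝ) i • embed d (g i) := by
    apply Subtype.ext
    funext j
    have h0 : ∑ i, (v : Fin (d + 1) → ℝ) i = 0 := v.2
    rw [Submodule.coe_sum, Finset.sum_apply]
    simp only [Submodule.coe_smul, Pi.smul_apply, smul_eq_mul, embed_g_apply, mul_sub,
      Finset.sum_sub_distrib, ← Finset.sum_mul, h0]
    simp
  conv_rhs => rw [hv, map_sum]
  rw [coeffDual_apply]
  exact Finset.sum_congr rfl fun i _ => by rw [map_smul, smul_eq_mul, mul_comm]

/-- Integer vectors with sum zero that approximate `n s`. -/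
def approxCoeff (s : Module.Dual ℝ (H d)) (n : ℕ) : Fin (d + 1) → ℤ :=
  Fin.cons (-∑ j : Fin d, ⌈n * s (embed d (g j.succ))⌉) fun j => ⌈n * s (embed d (g j.succ))⌉

/-- Rational slopes that approximate `s`. -/
def approxSlope (s : Module.Dual ℝ (H d)) (n : ℕ) : Module.Dual ℝ (H d) :=
  coeffDual fun i => (approxCoeff s n i : ℝ) / n

theorem approxSlope_embed_g (s : Module.Dual ℝ (H d)) (n : ℕ) (i : Fin (d + 1)) :
    approxSlope s n (embed d (g i)) = (approxCoeff s n i : ℝ) / n := by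
  refine coeffDual_embed_g ?_ i
  rw [← Finset.sum_div, ← Int.cast_sum, Fin.sum_univ_succ]
  simp [approxCoeff]

/-- Rounding up keeps the later coefficients at most n because n is an integer, and it only lowers
the first one, which is minus their sum and stays below n s(g_0) ≤ n. -/
theorem approxSlope_mem_slopesN {s : Module.Dual ℝ (H d)} (hs : s ∈ slopes d) {n : ℕ}
    (hn : 0 < n) : approxSlope s n ∈ slopesN d n := by
  have hn' : (0 : ℝ) < n := by exact_mod_cast hn
  refine ⟨fun i => ?_, fun i => ⟨_, approxSlope_embed_g s n i⟩⟩
  rw [approxSlope_embed_g, div_le_one hn']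
  refine Fin.cases ?_ (fun j => ?_) i
  · have h0 := sum_slope_eq_zero s
    rw [Fin.sum_univ_succ] at h0
    have h1 : (n : ℝ) * ∑ j : Fin d, s (embed d (g j.succ)) ≤
        ∑ j : Fin d, (⌈n * s (embed d (g j.succ))⌉ : ℝ) := by
      rw [Finset.mul_sum]
      exact Finset.sum_le_sum fun j _ => Int.le_ceil _
    have h2 := hs 0
    simp only [approxCoeff, Fin.cons_zero]
    push_cast
    nlinarith
  · simp only [approxCoeff, Fin.cons_succ]
    have : ⌈(n : ℝ) * s (embed d (g j.succ))⌉ ≤ (n : ℤ) := by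
      rw [Int.ceil_le]
      push_cast
      nlinarith [hs j.succ]
    exact_mod_cast this

theorem tendsto_ceil_mul_div (a : ℝ) :
    Tendsto (fun n : ℕ => (⌈(n : ℝ) * a⌉ : ℝ) / n) atTop (𝓝 a) := by
  have h1 : Tendsto (fun n : ℕ => a + 1 / (n : ℝ)) atTop (𝓝 a) := by
    simpa using tendsto_const_nhds.add (tendsto_one_div_atTop_nhds_zero_nat (𝕜 := ℝ))
  refine tendsto_of_tendsto_of_tendsto_of_le_of_le' tendsto_const_nhds h1 ?_ ?_
  · filter_upwards [eventually_gt_atTop 0] with n hn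
    have hn' : (0 : ℝ) < n := by exact_mod_cast hn
    rw [le_div_iff₀ hn', mul_comm]
    exact Int.le_ceil _
  · filter_upwards [eventually_gt_atTop 0] with n hn
    have hn' : (0 : ℝ) < n := by exact_mod_cast hn
    rw [div_le_iff₀ hn', add_mul, one_div, inv_mul_cancel₀ hn'.ne', mul_comm a]
    exact (Int.ceil_lt_add_one _).le

theorem tendsto_approxSlope (s : Module.Dual ℝ (H d)) (v : H d) :
    Tendsto (fun n => approxSlope s n v) atTop (𝓝 (s v)) := by
  conv => rhs; rw [← coeffDual_slope s]
  simp only [approxSlope, coeffDual_apply]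
  refine tendsto_finsetSum _ fun i _ => Tendsto.mul_const _ ?_
  refine Fin.cases ?_ (fun j => ?_) i
  · have h0 := sum_slope_eq_zero s
    rw [Fin.sum_univ_succ] at h0
    have e : s (embed d (g 0)) = -∑ j : Fin d, s (embed d (g j.succ)) := by linarith
    rw [e]
    simp only [approxCoeff, Fin.cons_zero, Int.cast_neg, Int.cast_sum, neg_div, Finset.sum_div]
    exact (tendsto_finsetSum _ fun j _ => tendsto_ceil_mul_div _).neg
  · simp only [approxCoeff, Fin.cons_succ]
    exact tendsto_ceil_mul_div _

end Slopes

/-! ### Variance of sub-Gaussian variables. -/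

section SubGaussian

theorem one_add_sq_div_two_le_cosh (x : ℝ) : 1 + x ^ 2 / 2 ≤ Real.cosh x := by
  have h1 : |x / 2| ≤ |Real.sinh (x / 2)| := by
    rw [Real.abs_sinh]
    exact Real.self_le_sinh_iff.mpr (abs_nonneg _)
  have h2 := sq_le_sq.mpr h1
  have h3 := Real.cosh_two_mul (x / 2)
  rw [Real.cosh_sq] at h3
  rw [show 2 * (x / 2) = x by ring] at h3
  rw [h3]
  nlinarith

theorem le_of_forall_sq_mul_le_exp {V c : ℝ} (hc : 0 ≤ c)
    (h : ∀ l : ℝ, 1 + l ^ 2 * V / 2 ≤ Real.exp (c * l ^ 2 / 2)) : V ≤ c := by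
  have key : ∀ᶠ l : ℝ in 𝓝[>] 0, V ≤ c + c ^ 2 * l ^ 2 / 2 := by
    have hsmall : ∀ᶠ l : ℝ in 𝓝[>] 0, c * l ^ 2 / 2 < 1 := by
      have : Tendsto (fun l : ℝ => c * l ^ 2 / 2) (𝓝[>] 0) (𝓝 (c * 0 ^ 2 / 2)) :=
        (Continuous.tendsto (by fun_prop) 0).mono_left nhdsWithin_le_nhds
      exact this.eventually_lt_const (by simp)
    filter_upwards [hsmall, self_mem_nhdsWithin] with l hl hl0
    have hl0 : 0 < l := hl0
    have h0 : 0 ≤ c * l ^ 2 / 2 := by positivity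
    -- Uses exp(u) ≤ 1 + u + u² for |u| ≤ 1 with u = cl²/2; dividing by l²/2 leaves an error c²l²/2,
    -- which vanishes as l → 0.
    have h1 := (abs_le.mp (Real.abs_exp_sub_one_sub_id_le (by rw [abs_of_nonneg h0]; exact hl.le))).2
    have h2 := h l
    have h3 : l ^ 2 * V ≤ l ^ 2 * (c + c ^ 2 * l ^ 2 / 2) := by nlinarith
    exact le_of_mul_le_mul_left h3 (by positivity)
  have hlim : Tendsto (fun l : ℝ => c + c ^ 2 * l ^ 2 / 2) (𝓝[>] 0) (𝓝 (c + c ^ 2 * 0 ^ 2 / 2)) :=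
    (Continuous.tendsto (by fun_prop) 0).mono_left nhdsWithin_le_nhds
  have := ge_of_tendsto hlim key
  simpa using this

/-- A sub-Gaussian random variable with parameter `c` has second moment at most `c`. -/
theorem integral_sq_le_of_hasSubgaussianMGF {Ω : Type*} [MeasurableSpace Ω] {μ : Measure Ω}
    [IsProbabilityMeasure μ] {Y : Ω → ℝ} {c : NNReal}
    (h : ProbabilityTheory.HasSubgaussianMGF Y c μ) : ∫ ω, Y ω ^ 2 ∂μ ≤ c := by
  refine le_of_forall_sq_mul_le_exp c.2 fun l => ?_
  have hsq : Integrable (fun ω => Y ω ^ 2) μ := (h.memLp 2).integrable_sq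
  have h1 := h.mgf_le l
  have h2 := h.mgf_le (-l)
  rw [neg_sq] at h2
  -- Averaging the bounds for l and -l removes the linear term, so no centring of `Y` is needed.
  have hcosh : ∫ ω, (1 + l ^ 2 * Y ω ^ 2 / 2) ∂μ ≤
      ∫ ω, (Real.exp (l * Y ω) + Real.exp (-l * Y ω)) / 2 ∂μ := by
    refine integral_mono ((integrable_const _).add ((hsq.const_mul _).div_const _))
      (((h.integrable_exp_mul l).add (h.integrable_exp_mul (-l))).div_const _) fun ω => ?_
    have := one_add_sq_div_two_le_cosh (l * Y ω)
    rw [Real.cosh_eq] at this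
    simp only [neg_mul]
    rwa [mul_pow] at this
  rw [integral_div, integral_add (h.integrable_exp_mul l) (h.integrable_exp_mul (-l)),
    integral_add (integrable_const _) ((hsq.const_mul _).div_const _), integral_div,
    integral_const_mul] at hcosh
  simp only [integral_const, probReal_univ, smul_eq_mul, mul_one] at hcosh
  simp only [ProbabilityTheory.mgf] at h1 h2
  linarith

end SubGaussian

/-! ### Passage to the limit. -/

section Limit

variable {d : ℕ}

theorem isLocal_comp_sub {β : Type*} (x y : X d) (φ : ℤ → β) :
    IsLocal {x, y} fun f : HeightFunction d => φ (f y - f x) := by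
  classical
  intro f h hfh
  have h1 := hfh x (by simp)
  have h2 := hfh y (by simp)
  exact congrArg φ (by linarith)

theorem uniformMeasure_shift_preimage {L : AddSubgroup (X d)} {s : Module.Dual ℝ (H d)}
    (hfin : (periodicBC L s).Finite) (v : X d) {A : Set (HeightFunction d)}
    (hA : MeasurableSet A) :
    uniformMeasure (periodicBC L s) (shift v ⁻¹' A) = uniformMeasure (periodicBC L s) A := by
  rw [uniformMeasure_apply hfin (measurable_shift v hA), uniformMeasure_apply hfin hA]
  congr 2
  conv_lhs => rw [← shift_preimage_periodicBC v, ← Set.preimage_inter]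
  refine Set.ncard_preimage_of_injective_subset_range (shift_injective v) fun f _ => ?_
  exact ⟨shift (-v) f, shift_shift_neg v f⟩

theorem IsLocal.preimage_shift {R : Finset (X d)} {A : Set (HeightFunction d)}
    (hA : IsLocal R (· ∈ A)) (v : X d) :
    ∃ R' : Finset (X d), IsLocal R' (· ∈ shift v ⁻¹' A) := by
  classical
  refine ⟨insert v (R.image (· + v)), fun f h hfh => ?_⟩
  refine hA (shift v f) (shift v h) fun x hx => ?_
  have h1 := hfh v (by simp)
  have h2 := hfh (x + v) (Finset.mem_insert_of_mem (Finset.mem_image_of_mem _ hx))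
  simp only [shift, zero_add]
  linarith

/-- Everything that passes from the periodic measures to a local limit. -/
theorem limit_properties (hd : 1 ≤ d) {s : Module.Dual ℝ (H d)} {t : ℕ → Module.Dual ℝ (H d)}
    {k : ℕ → ℕ} (hk : StrictMono k) (hpos : ∀ j, 0 < k j) (ht : ∀ n, 0 < n → t n ∈ slopesN d n)
    (hts : ∀ v, Tendsto (fun n => t n v) atTop (𝓝 (s v))) {μ : Measure (HeightFunction d)}
    [IsProbabilityMeasure μ]
    (hlim : ∀ (R : Finset (X d)) (F : HeightFunction d → ℝ), IsLocal R F →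
      Tendsto (fun j => ∫ f, F f ∂(uniformMeasure (periodicBC (latticeN d (k j)) (t (k j)))))
        atTop (𝓝 (∫ f, F f ∂μ))) :
    IsShiftInvariant μ ∧ IsGradientGibbs μ ∧ HasSlope μ s ∧
      (∀ x y, ProbabilityTheory.HasSubgaussianMGF
        (fun f : HeightFunction d => (f y : ℝ) - f x - s (embed d (y - x)))
        (((d : NNReal) + 1) ^ 2 * (graph d).dist x y) μ) ∧
      LocallyConverges (fun j => uniformMeasure (periodicBC (latticeN d (k j)) (t (k j)))) μ := by
  classical
  have hfin : ∀ j, (periodicBC (latticeN d (k j)) (t (k j))).Finite :=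
    fun j => finite_periodicBC (hpos j) _
  have hne : ∀ j, (periodicBC (latticeN d (k j)) (t (k j))).Nonempty :=
    fun j => nonempty_periodicBC (hpos j) (ht _ (hpos j))
  have hprob : ∀ j, IsProbabilityMeasure (uniformMeasure (periodicBC (latticeN d (k j)) (t (k j)))) :=
    fun j => isProbabilityMeasure_uniformMeasure (hfin j) (hne j)
  have hcard : ∀ j, (0 : ℝ) < (hfin j).toFinset.card := fun j => by
    have := (hfin j).toFinset_nonempty.mpr (hne j)
    exact_mod_cast this.card_pos
  have hktop : Tendsto k atTop atTop := hk.tendsto_atTop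
  have hmeas : ∀ (R : Finset (X d)) (A : Set (HeightFunction d)), IsLocal R (· ∈ A) →
      Tendsto (fun j => uniformMeasure (periodicBC (latticeN d (k j)) (t (k j))) A)
        atTop (𝓝 (μ A)) := fun R A hA => tendsto_measure_of_tendsto_integral hlim hA
  refine ⟨?_, ?_, ?_, ?_, ?_⟩
  · intro v A hA
    rw [image_shift, ← Measure.map_apply (measurable_shift (-v)) hA]
    have : IsProbabilityMeasure (μ.map (shift (-v))) :=
      Measure.isProbabilityMeasure_map (measurable_shift (-v)).aemeasurable
    have e : μ.map (shift (-v)) = μ := by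
      refine ext_of_localEvents fun R B hB => ?_
      have hB' := measurableSet_of_isLocal hB
      rw [Measure.map_apply (measurable_shift (-v)) hB']
      obtain ⟨R', hR'⟩ := hB.preimage_shift (-v)
      refine tendsto_nhds_unique (hmeas R' _ hR') ?_
      refine Tendsto.congr (fun j => ?_) (hmeas R B hB)
      exact (uniformMeasure_shift_preimage (hfin j) (-v) hB').symm
    rw [e]
  -- Both sides of the DLR equation are integrals of local functions, and the equation holds along
  -- the sequence once `T` injects into the torus.
  · refine isGradientGibbs_of_local hd fun R T z A hT hz hzT hA => ?_
    have hloc : IsLocal T fun f => (uniformMeasure (fixedBC R f) A).toReal := fun f f' h =>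
      congrArg ENNReal.toReal (isLocal_uniformMeasure_fixedBC hT hz hA f f' h)
    refine tendsto_nhds_unique (hlim T _ hloc) ?_
    have h1 := (ENNReal.tendsto_toReal (measure_ne_top μ A)).comp (hmeas T A hA)
    refine Tendsto.congr' ?_ h1
    filter_upwards [hktop.eventually (eventually_injOn_latticeN T)] with j hj
    exact (integral_uniformMeasure_fixedBC_periodicBC hT (hfin j) hj hz hzT hA).symm
  · intro x
    have hloc : IsLocal {0, x} fun f : HeightFunction d => (f x : ℝ) - f 0 := by
      have := isLocal_comp_sub (0 : X d) x (fun k : ℤ => (k : ℝ))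
      simpa only [Int.cast_sub] using this
    refine tendsto_nhds_unique (hlim _ _ hloc) ?_
    refine Tendsto.congr (fun j => ?_) ((hts (embed d x)).comp hktop)
    rw [integral_uniformMeasure (hfin j) hloc.measurable, eq_div_iff (hcard j).ne', mul_comm,
      Function.comp_apply, ← sum_periodicBC (hpos j)]
    refine Finset.sum_congr rfl fun f hf => ?_
    rw [((hfin j).mem_toFinset.mp hf).1]
    simp
  · intro x y
    have hloc : ∀ l : ℝ, IsLocal {x, y} fun f : HeightFunction d =>
        Real.exp (l * ((f y : ℝ) - f x - s (embed d (y - x)))) := by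
      intro l
      have := isLocal_comp_sub x y
        (fun k : ℤ => Real.exp (l * ((k : ℝ) - s (embed d (y - x)))))
      simpa only [Int.cast_sub] using this
    refine ⟨fun l => (hloc l).integrable μ, fun l => ?_⟩
    rw [ProbabilityTheory.mgf]
    set E := Real.exp (l ^ 2 * ((d : ℝ) + 1) ^ 2 / 2 * ((graph d).dist x y : ℝ)) with hE
    have hE' : Real.exp (((((d : NNReal) + 1) ^ 2 * (graph d).dist x y : NNReal) : ℝ) * l ^ 2 / 2) =
        E := by
      rw [hE]; congr 1; push_cast; ring
    rw [hE']
    -- The periodic measure is centred at `t (k j)` instead of `s`; recentring costs a factor that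
    -- tends to 1.
    have hb : ∀ j, ∫ f, Real.exp (l * ((f y : ℝ) - f x - s (embed d (y - x))))
        ∂(uniformMeasure (periodicBC (latticeN d (k j)) (t (k j)))) ≤
        Real.exp (l * (t (k j) (embed d (y - x)) - s (embed d (y - x)))) * E := by
      intro j
      rw [integral_uniformMeasure (hfin j) (hloc l).measurable, div_le_iff₀ (hcard j)]
      have h1 := sum_exp_periodicBC_le (hpos j) (ht _ (hpos j)) x y l
      have h2 : ∑ f ∈ (hfin j).toFinset, Real.exp (l * ((f y : ℝ) - f x - s (embed d (y - x)))) =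
          Real.exp (l * (t (k j) (embed d (y - x)) - s (embed d (y - x)))) *
          ∑ f ∈ (hfin j).toFinset,
            Real.exp (l * ((f y : ℝ) - f x - t (k j) (embed d (y - x)))) := by
        rw [Finset.mul_sum]
        refine Finset.sum_congr rfl fun f _ => ?_
        rw [← Real.exp_add]; congr 1; ring
      rw [h2, mul_assoc, mul_comm E]
      exact mul_le_mul_of_nonneg_left h1 (Real.exp_pos _).le
    have hlimE : Tendsto (fun j =>
        Real.exp (l * (t (k j) (embed d (y - x)) - s (embed d (y - x)))) * E) atTop (𝓝 E) := by
      have h1 := (((hts (embed d (y - x))).comp hktop).sub_const (s (embed d (y - x)))).const_mul l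
      have h2 := ((Real.continuous_exp.tendsto _).comp h1).mul_const E
      simpa using h2
    exact le_of_tendsto_of_tendsto' (hlim _ _ (hloc l)) hlimE hb
  · intro R hR A hA hAR
    refine hmeas hR.toFinset A (isLocal_of_measurableSet hA ?_)
    rwa [hR.coe_toFinset]

end Limit

end SimplicialLattice

end

open SimplicialLattice
theorem mainTheorem7 (d : ℕ) (hd : 2 ≤ d) (s : Module.Dual ℝ (H d)) (hs : s ∈ slopes d) :
    ∃ μ : Measure (HeightFunction d),
      IsProbabilityMeasure μ ∧ IsShiftInvariant μ ∧ IsGradientGibbs μ ∧ HasSlope μ s ∧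
      (∀ x y : X d,
        ProbabilityTheory.variance (fun f : HeightFunction d => (f y : ℝ) - (f x : ℝ)) μ
          ≤ ((d : ℝ) + 1) ^ 2 * ((graph d).dist x y : ℝ)) ∧
      (∀ x y : X d, 0 < (graph d).dist x y → ∀ a : ℝ, 0 ≤ a →
        μ.real {f | (f y : ℝ) - (f x : ℝ) - s (embed d (y - x)) ≥ ((d : ℝ) + 1) * a}
          ≤ Real.exp (-(a ^ 2 / (2 * ((graph d).dist x y : ℝ))))) ∧
      (∀ x y : X d, 0 < (graph d).dist x y → ∀ a : ℝ, a ≤ 0 →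
        μ.real {f | (f y : ℝ) - (f x : ℝ) - s (embed d (y - x)) ≤ ((d : ℝ) + 1) * a}
          ≤ Real.exp (-(a ^ 2 / (2 * ((graph d).dist x y : ℝ))))) ∧
      (∃ (t : ℕ → Module.Dual ℝ (H d)) (k : ℕ → ℕ),
        (∀ n, 0 < n → t n ∈ slopesN d n) ∧
        (∀ v : H d, Tendsto (fun n => t n v) atTop (𝓝 (s v))) ∧
        StrictMono k ∧ (∀ j, 0 < k j) ∧
        LocallyConverges (fun j => uniformMeasure (periodicBC (latticeN d (k j)) (t (k j)))) μ) := by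
  have ht : ∀ n, 0 < n → approxSlope s n ∈ slopesN d n := fun n hn => approxSlope_mem_slopesN hs hn
  have hprob : ∀ n, IsProbabilityMeasure
      (uniformMeasure (periodicBC (latticeN d (n + 1)) (approxSlope s (n + 1)))) := fun n =>
    isProbabilityMeasure_uniformMeasure (finite_periodicBC n.succ_pos _)
      (nonempty_periodicBC n.succ_pos (ht _ n.succ_pos))
  -- Indices start at n + 1 because finiteness and non-emptiness of the periodic sets require a
  -- positive period.
  obtain ⟨μ, hμ, k, hk, hlim⟩ := exists_local_limit fun n =>
    uniformMeasure (periodicBC (latticeN d (n + 1)) (approxSlope s (n + 1)))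
  have hk' : StrictMono fun j => k j + 1 := fun i j hij => Nat.succ_lt_succ (hk hij)
  obtain ⟨hshift, hgibbs, hslope, hsub, hconv⟩ := limit_properties (by omega) hk'
    (fun j => (k j).succ_pos) ht (tendsto_approxSlope s) hlim
  have hexp : ∀ x y : X d, 0 < (graph d).dist x y → ∀ a : ℝ,
      -(((d : ℝ) + 1) * a) ^ 2 /
        (2 * ((((d : NNReal) + 1) ^ 2 * (graph d).dist x y : NNReal) : ℝ)) =
      -(a ^ 2 / (2 * ((graph d).dist x y : ℝ))) := by
    intro x y hxy a
    have h1 : ((graph d).dist x y : ℝ) ≠ 0 := by exact_mod_cast hxy.ne'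
    have h2 : (d : ℝ) + 1 ≠ 0 := by positivity
    push_cast
    field_simp
  refine ⟨μ, hμ, hshift, hgibbs, hslope, fun x y => ?_, fun x y hxy a ha => ?_,
    fun x y hxy a ha => ?_, approxSlope s, fun j => k j + 1, ht, tendsto_approxSlope s, hk',
    fun j => (k j).succ_pos, hconv⟩
  · have hm : Measurable fun f : HeightFunction d => (f y : ℝ) - f x := by
      have := (isLocal_comp_sub x y (fun k : ℤ => (k : ℝ))).measurable
      simpa only [Int.cast_sub] using this
    rw [← ProbabilityTheory.variance_sub_const hm.aestronglyMeasurable (s (embed d (y - x)))]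
    refine (ProbabilityTheory.variance_le_expectation_sq
      (hsub x y).aestronglyMeasurable).trans ?_
    have := integral_sq_le_of_hasSubgaussianMGF (hsub x y)
    push_cast at this
    exact this
  -- Chernoff bound at (d + 1)a with parameter (d + 1)²n; the factors (d + 1)² cancel and leave
  -- a²/(2n).
  · have h := (hsub x y).measure_ge_le (ε := ((d : ℝ) + 1) * a) (by positivity)
    rw [hexp x y hxy] at h
    exact h
  · have h := (hsub x y).neg.measure_ge_le (ε := -(((d : ℝ) + 1) * a))
      (by have : (0 : ℝ) ≤ (d : ℝ) + 1 := by positivity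
          nlinarith)
    rw [neg_sq, hexp x y hxy] at h
    refine le_trans (le_of_eq ?_) h
    congr 1
    ext f
    simp only [Set.mem_ofPred_eq, Pi.neg_apply, neg_le_neg_iff]
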